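/- Let $\Theta$ be the graph with two vertices $0,1$ and four edges between them, and let $L=(\Theta\times\{0\}\times\{1\})\cup(\{1\}\times\Theta\times\{0\})\cup(\{0\}\times\{1\}\times\Theta)\subset\Theta^3$, a disjoint union of three copies of $\Theta$. For each $i\in\mathbb Z/3$, forgetting the $i$-th coordinate (and taking the coordinates $i+1,i+2$ in this order) maps $\Theta^3\setminus L$ to $\Theta^2\setminus\{(0,1)\}$. Choose for each $i$ a five-sheeted cover of $\Theta^2\setminus\{(0,1)\}$ whose monodromy around every $4$-cycle in the link $K_{4,4}$ of the missing vertex is a $5$-cycle, and pull it back to $\Theta^3\setminus L$. Let $X\to\Theta^3$ be a connected component of the ramified cover obtained by completing the fibre product of the three pulled-back covers (Brady's cube complex), and let $\widetilde X$ be the universal cover of $X$, with $1$-skeleton $\widetilde X^{(1)}$. A vertex or edge of $\widetilde X$ is called ramified if it lies over $L$. Let $R\subset\widetilde X^{(1)}$ be an isometrically embedded $(C\times D)$-rectangle, that is, a subgraph isomorphic to the grid $\{0,\dots,C\}\times\{0,\dots,D\}$, $C,D\in\mathbb N$, on which the path metrics of $R$ and of $\widetilde X^{(1)}$ agree. Then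 no connected component of the subgraph of $R$ formed by the ramified vertices and ramified edges of $R$ is disjoint from the boundary of $R$. In particular, no ramified vertex of $R$ that is not on the boundary of $R$ is isolated, that is, every such vertex is an end point of a ramified edge of $R$. -/

import Mathlib

/-!
`Θ` is the graph with the two vertices `0 = false`, `1 = true` and four edges, labelled by `Fin 4`.
The coordinates of `Θ³` are indexed by the cyclically ordered set `Fin 3`.

The ramification locus `L ⊂ Θ³` consists of three disjoint copies of `Θ`: the `i`-th one is parallel
to the `i`-th factor and is given by `x (i+1) = 0`, `x (i+2) = 1`, that is
`L = Θ × {0} × {1} ∪ {1} × Θ × {0} ∪ {0} × {1} × Θ`.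

Forgetting the `i`-th coordinate maps `Θ³ ∖ L` to `Θ² ∖ {(0,1)}`. A five-sheeted cover of the latter
is pulled back, for each `i`; the fibre product of the three pull-backs is a cover of `Θ³ ∖ L` with
fibre `{1,…,5}³`. The ramified cover `X → Θ³` is the completion of this cover: `X` is obtained from
the `3`-cubes of the cover by gluing them along their `2`-dimensional faces.
-/

namespace Brady

/-- The commutator of two permutations. -/
def comm (g h : Equiv.Perm (Fin 5)) : Equiv.Perm (Fin 5) := g * h * g⁻¹ * h⁻¹

/-- Three five-sheeted covers of `Θ² ∖ {(0,1)}`. This space deformation retracts to the wedge of the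
two copies `Θ × {0}` and `{1} × Θ` of `Θ`, so that a cover is given by the permutations `α i a`
(transport along the edge `a × {0}` from `(0,0)` to `(1,0)`) and `β i b` (transport along the edge
`{1} × b` from `(1,1)` to `(1,0)`). -/
structure Monodromy where
  α : Fin 3 → Fin 4 → Equiv.Perm (Fin 5)
  β : Fin 3 → Fin 4 → Equiv.Perm (Fin 5)

/-- The choice of the covers in the construction: around every `4`-cycle `(a, b, a', b')` in the link
`F ∗ F` of the missing point `(0,1)` of `Θ²`, the monodromy is a `5`-cycle. -/
def Monodromy.IsBrady (M : Monodromy) : Prop :=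
  ∀ i : Fin 3, ∀ a a' : Fin 4, a ≠ a' → ∀ b b' : Fin 4, b ≠ b' →
    (comm (M.α i a' * (M.α i a)⁻¹) (M.β i b' * (M.β i b)⁻¹)).cycleType = {5}

/-- A `3`-cube of the cover of `Θ³ ∖ L` with one of its eight corners marked: the cube lies over the
`3`-cube `e 0 × e 1 × e 2` of `Θ³`, on the sheet `s`, and the marked corner lies over `v`. The `i`-th
component of the sheet is read off at the corners where `x (i+1) = 1`, `x (i+2) = 0`. -/
@[ext]
structure Flag where
  e : Fin 3 → Fin 4
  s : Fin 3 → Fin 5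
  v : Fin 3 → Bool

/-- Move the marked corner along the edge in direction `k`. -/
def Flag.flip (k : Fin 3) (x : Flag) : Flag :=
  { x with v := Function.update x.v k (!x.v k) }

/-- Pass from a `3`-cube through the face perpendicular to direction `j` that contains the marked
corner, to the adjacent `3`-cube whose `j`-th edge is `c`. -/
def Flag.cross (M : Monodromy) (j : Fin 3) (c : Fin 4) (x : Flag) : Flag where
  e := Function.update x.e j c
  s := fun i =>
    if i + 1 = j ∧ x.v j = false then (M.α i c * (M.α i (x.e j))⁻¹) (x.s i)
    else if i + 2 = j ∧ x.v j = true then (M.β i c * (M.β i (x.e j))⁻¹) (x.s i)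
    else x.s i
  v := x.v

/-- The cells of `X` whose set of directions is `I`, with a marked corner. Faces of `3`-cubes are
identified when one gets from one cube to the other by crossing `2`-faces that contain them. -/
def MarkedCell (M : Monodromy) (I : Set (Fin 3)) : Type :=
  Quot fun x y : Flag => ∃ j, j ∉ I ∧ ∃ c, y = x.cross M j c

/-- The vertices of `X`. -/
abbrev Vertex (M : Monodromy) : Type := MarkedCell M ∅

/-- The oriented edges of `X`: an edge with its initial vertex marked. -/
def Dart (M : Monodromy) : Type := Σ k : Fin 3, MarkedCell M {k}

theorem Flag.flip_flip (k : Fin 3) (x : Flag) : (x.flip k).flip k = x := by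
  ext i <;> simp [Flag.flip]

theorem Flag.flip_comm (k l : Fin 3) (x : Flag) : (x.flip k).flip l = (x.flip l).flip k := by
  by_cases h : k = l
  · rw [h]
  · have h' : l ≠ k := fun t => h t.symm
    simp [Flag.flip, h, h', Function.update_comm h]

theorem Flag.cross_flip (M : Monodromy) {j k : Fin 3} (h : j ≠ k) (c : Fin 4) (x : Flag) :
    (x.cross M j c).flip k = (x.flip k).cross M j c := by
  ext i <;> simp [Flag.flip, Flag.cross, h]

variable {M : Monodromy}

/-- The vertex of `X` at the marked corner of a `3`-cube. -/
def Vertex.mk (M : Monodromy) (x : Flag) : Vertex M := Quot.mk _ x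

/-- The oriented edge of `X` that leaves the marked corner of a `3`-cube in direction `k`. -/
def Dart.mk (M : Monodromy) (k : Fin 3) (x : Flag) : Dart M := ⟨k, Quot.mk _ x⟩

/-- The initial vertex of an oriented edge. -/
def Dart.src (d : Dart M) : Vertex M :=
  Quot.lift (Vertex.mk M)
    (by rintro x y ⟨j, -, c, h⟩; exact Quot.sound ⟨j, Set.notMem_empty j, c, h⟩) d.2

/-- The same edge with the opposite orientation. -/
def Dart.rev (d : Dart M) : Dart M :=
  ⟨d.1, Quot.map (Flag.flip d.1)
    (by rintro x y ⟨j, hj, c, rfl⟩; exact ⟨j, hj, c, x.cross_flip M hj c⟩) d.2⟩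

/-- The terminal vertex of an oriented edge. -/
def Dart.tgt (d : Dart M) : Vertex M := d.rev.src

/-- The vertex of `Θ³` under a vertex of `X`. -/
def Vertex.corner (x : Vertex M) : Fin 3 → Bool :=
  Quot.lift Flag.v (by rintro x y ⟨j, -, c, rfl⟩; rfl) x

/-- A vertex of `X` is ramified if it lies over `L`. -/
def Vertex.IsRamified (x : Vertex M) : Prop :=
  ∃ i : Fin 3, x.corner (i + 1) = false ∧ x.corner (i + 2) = true

/-- An edge of `X` is ramified if it lies over `L`: an edge in direction `k` can only lie over the
component of `L` parallel to the `k`-th factor. -/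
def Dart.IsRamified (d : Dart M) : Prop :=
  d.src.corner (d.1 + 1) = false ∧ d.src.corner (d.1 + 2) = true

/-- The boundary loop, based at the marked corner, of the `2`-cube with directions `k ≠ l` at the
marked corner of a `3`-cube. -/
def squareLoop (M : Monodromy) (x : Flag) (k l : Fin 3) : List (Dart M) :=
  [Dart.mk M k x, Dart.mk M l (x.flip k), Dart.mk M k ((x.flip k).flip l), Dart.mk M l (x.flip l)]

/-- `l` is an edge path in `X` with initial vertex `x`. -/
def IsPath : Vertex M → List (Dart M) → Prop
  | _, [] => True
  | x, d :: l => d.src = x ∧ IsPath d.tgt l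

/-- The terminal vertex of the edge path `l` with initial vertex `x`. -/
def endpoint : Vertex M → List (Dart M) → Vertex M
  | x, [] => x
  | _, d :: l => endpoint d.tgt l

/-- Elementary homotopies of edge paths: removing a backtrack or the boundary loop of a `2`-cube. -/
inductive Step : List (Dart M) → List (Dart M) → Prop
  | backtrack (u : List (Dart M)) (d : Dart M) (w : List (Dart M)) :
      Step (u ++ [d, d.rev] ++ w) (u ++ w)
  | square (u : List (Dart M)) (x : Flag) (k l : Fin 3) (h : k ≠ l) (w : List (Dart M)) :
      Step (u ++ squareLoop M x k l ++ w) (u ++ w)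

/-- The edge paths in `X` that start at `x₀`. -/
def PathFrom (x₀ : Vertex M) : Type := {l : List (Dart M) // IsPath x₀ l}

/-- The vertices of the universal cover of (the component of `x₀` in) `X`: homotopy classes, with
endpoints fixed, of edge paths that start at `x₀`. -/
def Cover (x₀ : Vertex M) : Type := Quot fun p q : PathFrom x₀ => Step p.1 q.1

theorem isPath_append (x : Vertex M) (u w : List (Dart M)) :
    IsPath x (u ++ w) ↔ IsPath x u ∧ IsPath (endpoint x u) w := by
  induction u generalizing x with
  | nil => simp [IsPath, endpoint]
  | cons d u ih => simp [IsPath, endpoint, ih, and_assoc]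

theorem endpoint_append (x : Vertex M) (u w : List (Dart M)) :
    endpoint x (u ++ w) = endpoint (endpoint x u) w := by
  induction u generalizing x with
  | nil => rfl
  | cons d u ih => exact ih _

theorem Dart.exists_mk (d : Dart M) : ∃ k x, d = Dart.mk M k x := by
  obtain ⟨k, q⟩ := d
  obtain ⟨x, rfl⟩ := Quot.exists_rep q
  exact ⟨k, x, rfl⟩

theorem Dart.rev_mk (k : Fin 3) (x : Flag) : (Dart.mk M k x).rev = Dart.mk M k (x.flip k) := rfl

theorem Dart.src_mk (k : Fin 3) (x : Flag) : (Dart.mk M k x).src = Vertex.mk M x := rfl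

theorem Dart.tgt_mk (k : Fin 3) (x : Flag) :
    (Dart.mk M k x).tgt = Vertex.mk M (x.flip k) := rfl

theorem Dart.rev_rev (d : Dart M) : d.rev.rev = d := by
  obtain ⟨k, x, rfl⟩ := d.exists_mk
  simp only [Dart.rev_mk, Flag.flip_flip]

theorem Dart.corner_tgt (d : Dart M) :
    d.tgt.corner = Function.update d.src.corner d.1 (!d.src.corner d.1) := by
  obtain ⟨k, x, rfl⟩ := d.exists_mk
  rfl

theorem Dart.IsRamified.rev {d : Dart M} (h : d.IsRamified) : d.rev.IsRamified := by
  obtain ⟨k, x, rfl⟩ := d.exists_mk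
  have h1 : k + 1 ≠ k := (by decide : ∀ k : Fin 3, k + 1 ≠ k) k
  have h2 : k + 2 ≠ k := (by decide : ∀ k : Fin 3, k + 2 ≠ k) k
  have e1 : (x.flip k).v (k + 1) = x.v (k + 1) := Function.update_of_ne h1 _ _
  have e2 : (x.flip k).v (k + 2) = x.v (k + 2) := Function.update_of_ne h2 _ _
  exact ⟨e1.trans h.1, e2.trans h.2⟩

theorem Step.endpoint_eq {x : Vertex M} {p q : List (Dart M)} (h : Step p q) (hp : IsPath x p) :
    endpoint x p = endpoint x q := by
  cases h with
  | backtrack u d w =>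
    simp only [isPath_append, IsPath] at hp
    simp only [endpoint_append, endpoint]
    rw [Dart.tgt, Dart.rev_rev, hp.1.2.1]
  | square u y k l h w =>
    simp only [isPath_append, IsPath, squareLoop] at hp
    simp only [endpoint_append, endpoint, squareLoop]
    rw [Dart.tgt_mk, Flag.flip_flip, ← hp.1.2.1, Dart.src_mk]

variable {x₀ : Vertex M}

/-- The covering projection on vertices. -/
def Cover.proj (a : Cover x₀) : Vertex M :=
  Quot.lift (fun p : PathFrom x₀ => endpoint x₀ p.1) (fun p _ h => Step.endpoint_eq h p.2) a

/-- A vertex of the universal cover is ramified if it lies over the ramification locus. -/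
def Cover.IsRamified (a : Cover x₀) : Prop := a.proj.IsRamified

/-- `a` and `b` are joined by an edge of the universal cover, namely the lift at `a` of an oriented
edge `d` of `X` with the property `P`. -/
def Cover.Edge (P : Dart M → Prop) (a b : Cover x₀) : Prop :=
  ∃ (p : PathFrom x₀) (d : Dart M) (h : IsPath x₀ (p.1 ++ [d])),
    P d ∧ a = Quot.mk _ p ∧ b = Quot.mk _ ⟨p.1 ++ [d], h⟩

theorem Cover.Edge.exists_dart {P : Dart M → Prop} {a b : Cover x₀} (h : Cover.Edge P a b) :
    ∃ d : Dart M, P d ∧ d.src = a.proj ∧ d.tgt = b.proj := by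
  obtain ⟨p, d, hd, hP, rfl, rfl⟩ := h
  refine ⟨d, hP, ((isPath_append _ _ _).1 hd).2.1, ?_⟩
  change _ = endpoint _ (p.1 ++ [d])
  rw [endpoint_append]
  rfl

theorem Cover.Edge.symm {P : Dart M → Prop} (hP : ∀ d, P d → P d.rev) {a b : Cover x₀}
    (h : Cover.Edge P a b) : Cover.Edge P b a := by
  obtain ⟨p, d, hd, hPd, rfl, rfl⟩ := h
  have hq : IsPath x₀ ((p.1 ++ [d]) ++ [d.rev]) :=
    (isPath_append _ _ _).2 ⟨hd, by rw [endpoint_append]; exact ⟨rfl, trivial⟩⟩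
  refine ⟨⟨p.1 ++ [d], hd⟩, d.rev, hq, hP d hPd, rfl, (Quot.sound ?_).symm⟩
  simpa using Step.backtrack p.1 d []

/-- The graph formed by the lifts to the universal cover of the edges of `X` with the property `P`. -/
def edgeGraph (x₀ : Vertex M) (P : Dart M → Prop) (hP : ∀ d, P d → P d.rev) :
    SimpleGraph (Cover x₀) where
  Adj a b := Cover.Edge P a b
  symm := ⟨fun _ _ h => h.symm hP⟩
  loopless := ⟨fun a h => by
    obtain ⟨d, -, h1, h2⟩ := h.exists_dart
    have h3 := congrFun d.corner_tgt d.1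
    rw [Function.update_self, h1, h2] at h3
    cases hc : a.proj.corner d.1 <;> simp [hc] at h3⟩

/-- The `1`-skeleton of the universal cover. -/
def skeleton (x₀ : Vertex M) : SimpleGraph (Cover x₀) :=
  edgeGraph x₀ (fun _ => True) fun _ _ => trivial

/-- The graph formed by the ramified edges of the universal cover. -/
def ramifiedGraph (x₀ : Vertex M) : SimpleGraph (Cover x₀) :=
  edgeGraph x₀ Dart.IsRamified fun _ h => h.rev

theorem ramifiedGraph_isRamified {a b : Cover x₀} (h : (ramifiedGraph x₀).Adj a b) :
    a.IsRamified := by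
  obtain ⟨d, hd, h1, -⟩ := Cover.Edge.exists_dart h
  refine ⟨d.1, ?_⟩
  rw [← h1]
  exact hd

/-- The `(C × D)`-rectangle. -/
def rectangle (C D : ℕ) : SimpleGraph (Fin (C + 1) × Fin (D + 1)) :=
  SimpleGraph.boxProd (SimpleGraph.pathGraph (C + 1)) (SimpleGraph.pathGraph (D + 1))

/-- The vertices on the boundary of the `(C × D)`-rectangle. -/
def rectangleBoundary (C D : ℕ) : Set (Fin (C + 1) × Fin (D + 1)) :=
  {p | p.1 = 0 ∨ p.1 = Fin.last C ∨ p.2 = 0 ∨ p.2 = Fin.last D}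

/-- `φ` is an isometric embedding of the graph `G` into the graph `G'`. -/
def IsIsometricEmbedding {V W : Type*} (G : SimpleGraph V) (G' : SimpleGraph W) (φ : V → W) : Prop :=
  ∀ p q, G'.edist (φ p) (φ q) = G.edist p q

/-- The ramified part of a rectangle in the `1`-skeleton of the universal cover: its ramified
vertices and its ramified edges. -/
def ramifiedPart {C D : ℕ} (φ : Fin (C + 1) × Fin (D + 1) → Cover x₀) :
    (rectangle C D).Subgraph where
  verts := {p | (φ p).IsRamified}
  Adj p q := (rectangle C D).Adj p q ∧ (ramifiedGraph x₀).Adj (φ p) (φ q)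
  adj_sub h := h.1
  edge_vert h := ramifiedGraph_isRamified h.2
  symm := ⟨fun _ _ h => ⟨h.1.symm, h.2.symm⟩⟩

/-- The affine permutation `t ↦ 2 t + c` of `ℤ/5`. -/
def affinePerm (c : Fin 5) : Equiv.Perm (Fin 5) where
  toFun t := 2 * t + c
  invFun t := 3 * (t - c)
  left_inv := by revert c; decide
  right_inv := by revert c; decide

/-- An explicit choice of the covers, through powers of two `4`-cycles in `S₅`. -/
def affineMonodromy : Monodromy where
  α _ a := affinePerm 0 ^ (a : ℕ)
  β _ b := affinePerm 1 ^ (b : ℕ)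

theorem affineMonodromy_isBrady : affineMonodromy.IsBrady := by
  have key : ∀ a a' : Fin 4, a ≠ a' → ∀ b b' : Fin 4, b ≠ b' →
      (comm (affinePerm 0 ^ (a' : ℕ) * (affinePerm 0 ^ (a : ℕ))⁻¹)
        (affinePerm 1 ^ (b' : ℕ) * (affinePerm 1 ^ (b : ℕ))⁻¹)).support.card = 5 ∧
      (comm (affinePerm 0 ^ (a' : ℕ) * (affinePerm 0 ^ (a : ℕ))⁻¹)
        (affinePerm 1 ^ (b' : ℕ) * (affinePerm 1 ^ (b : ℕ))⁻¹)) ^ 5 = 1 := by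
    decide +kernel
  intro i a a' h b b' h'
  obtain ⟨h1, h2⟩ := key a a' h b b' h'
  have hp : Fact (Nat.Prime 5) := ⟨by norm_num⟩
  have h3 : orderOf (comm (affinePerm 0 ^ (a' : ℕ) * (affinePerm 0 ^ (a : ℕ))⁻¹)
        (affinePerm 1 ^ (b' : ℕ) * (affinePerm 1 ^ (b : ℕ))⁻¹)) = 5 := by
    refine orderOf_eq_prime h2 fun h0 => ?_
    rw [h0] at h1
    simp at h1
  have hc := Equiv.Perm.isCycle_of_prime_order' (h3 ▸ hp.out) (by rw [h3]; simp)
  have := hc.cycleType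
  rw [h1] at this
  exact this

end Brady

/-! Suppose a component of the ramified part lies in the interior of $R$, and take a vertex of it
over the $i$-th copy of $\Theta$. Adjacent sides of a square have different directions, so at this
vertex the sides of $R$ in direction $i$ are all horizontal or all vertical; up to transposing $R$,
no vertical side has direction $i$. Extend the vertex to a maximal horizontal segment $\sigma$ of
ramified edges, possibly a single vertex. Its ends are still interior.

The edges of $R$ that leave $\sigma$ upwards all give the same vertex $U$ of the link of that
component of $L$, and those that leave it downwards the same vertex $B$. The edges that prolong
$\sigma$ beyond its left and right ends give vertices $E$ and $R$ of this link. The unit squares of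
the rectangle at the two ends make $E,U,R,B$ a closed path of length four. A closed path without
backtracks would give a fixed point of a commutator that is a $5$-cycle on five points
(`link_cycle`), so $U=B$ or $E=R$. The first makes two vertices of the rectangle coincide. In the
second, pushing the left edge along $\sigma$ joins the neighbours of $\sigma$ on its line by a path
of length $|\sigma|$, while their distance is $|\sigma|+2$ (`not_segment`).

This uses that every unit square of $R$ is a $2$-cube of $\widetilde X$, that is, that embedded
$4$-cycles in the universal cover bound squares. Links in $X$ are flag (`Sim.pair`,
`Sim.exists_cube`), and for such square complexes there is a combinatorial normal form: reduced
words, up to exchanging the two ways around a square. Edge paths act on the classes of reduced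
words, elementary homotopies act trivially (`Step.same`), and comparing two paths of length two on
the empty word produces the square (`Same.sw_of_pair`, `IsLift.sw`). -/

namespace Brady

/-! ### Reduced words in a square complex with flag links -/

/-- The oriented edges of a square complex, with the relation `sw d e a b` saying that the paths
`d, e` and `a, b` are the two ways from a corner of a square to the opposite one. Two edges at a
vertex span at most one square, and three squares at a vertex whose edges match up pairwise are
contained in a `3`-cube. -/
structure SquareSystem (T : Type*) where
  rev : T → T
  sw : T → T → T → T → Prop
  rev_rev : ∀ d, rev (rev d) = d
  symm : ∀ {d e a b}, sw d e a b → sw a b d e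
  rot : ∀ {d e a b}, sw d e a b → sw (rev d) a e (rev b)
  unique : ∀ {d e a b a' b'}, sw d e a b → sw d e a' b' → a = a' ∧ b = b'
  ne_rev : ∀ {d e a b}, sw d e a b → e ≠ rev d
  cube : ∀ {e₂ d₁ d₂ e₁ f f₁ d f₂ e}, sw e₂ d₁ d₂ e₁ → sw d₁ f f₁ d → sw e₁ f f₂ e →
    ∃ f₃ e₃ d₃, sw e₂ f₁ f₃ e₃ ∧ sw d₂ f₂ f₃ d₃ ∧ sw e₃ d d₃ e

namespace SquareSystem

variable {T : Type*} (S : SquareSystem T)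

theorem rot' {f x g y : T} (h : S.sw f x g y) : S.sw x (S.rev y) (S.rev f) g :=
  S.symm (S.rot h)

theorem unique_left {f f' x g g' y : T} (h : S.sw f x g y) (h' : S.sw f' x g' y) :
    f = f' ∧ g = g' := by
  obtain ⟨h1, h2⟩ := S.unique (S.rot' h) (S.rot' h')
  exact ⟨by rw [← S.rev_rev f, h1, S.rev_rev], h2⟩

theorem last_ne {f x g y : T} (h : S.sw f x g y) : x ≠ y := by
  rintro rfl
  exact S.ne_rev (S.rot' h) rfl

theorem first_ne {f x g y : T} (h : S.sw f x g y) : f ≠ g := by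
  rintro rfl
  exact S.ne_rev (S.rot h) (S.rev_rev f).symm

/-- Equivalence of words up to replacing the path along two sides of a square by the path along the
other two. Words are written from right to left: the last letter is the head of the list. -/
inductive Eqv : List T → List T → Prop
  | refl (w) : Eqv w w
  | cons (d) {w w'} : Eqv w w' → Eqv (d :: w) (d :: w')
  | swap {f d g e} (t) : S.sw f d g e → Eqv (d :: f :: t) (e :: g :: t)
  | trans {u v w} : Eqv u v → Eqv v w → Eqv u w

variable {S}

theorem Eqv.symm {u v : List T} (h : S.Eqv u v) : S.Eqv v u := by
  induction h with
  | refl => exact .refl _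
  | cons d _ ih => exact .cons d ih
  | swap t h => exact .swap t (S.symm h)
  | trans _ _ h1 h2 => exact h2.trans h1

theorem Eqv.length_eq {u v : List T} (h : S.Eqv u v) : u.length = v.length := by
  induction h with
  | refl => rfl
  | cons d _ ih => simp [ih]
  | swap t h => rfl
  | trans _ _ h1 h2 => exact h1.trans h2

/-- The alternatives for equivalent words `d :: w` and `e :: w'`. -/
def Lcm (S : SquareSystem T) (d e : T) (w w' : List T) : Prop :=
  (d = e ∧ S.Eqv w w') ∨ ∃ t f g, S.sw f d g e ∧ S.Eqv w (f :: t) ∧ S.Eqv w' (g :: t)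

/-- A confluence argument: the outer induction is on the length, the inner one on the derivation of
the equivalence. Only transitivity matters, and there the cube condition closes up the
configuration. -/
theorem Lcm.of_eqv_aux (n : ℕ) : ∀ {X Y : List T}, S.Eqv X Y → X.length ≤ n →
    ∀ {d w e w'}, X = d :: w → Y = e :: w' → S.Lcm d e w w' := by
  induction n with
  | zero =>
    rintro X Y - h d w e w' rfl -
    simp at h
  | succ n ih =>
    intro X Y h
    induction h with
    | refl =>
      rintro - d w e w' rfl h
      obtain ⟨rfl, rfl⟩ := List.cons.inj h
      exact .inl ⟨rfl, .refl _⟩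
    | cons d h _ =>
      rintro - d w e w' h1 h2
      obtain ⟨rfl, rfl⟩ := List.cons.inj h1
      obtain ⟨rfl, rfl⟩ := List.cons.inj h2
      exact .inl ⟨rfl, h⟩
    | swap t h =>
      rintro - d w e w' h1 h2
      obtain ⟨rfl, rfl⟩ := List.cons.inj h1
      obtain ⟨rfl, rfl⟩ := List.cons.inj h2
      exact .inr ⟨t, _, _, h, .refl _, .refl _⟩
    | @trans _ Z _ hXZ hZY ih1 ih2 =>
      rintro hn d w e w' rfl rfl
      have hl := hXZ.length_eq
      match Z, hl with
      | f :: w'', hl =>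
      have hw : w''.length ≤ n := by simp at hl hn; omega
      rcases ih1 hn rfl rfl with ⟨rfl, h1⟩ | ⟨u, f₁, d₁, s1, h1, h1'⟩
      · rcases ih2 (hl ▸ hn) rfl rfl with ⟨rfl, h2⟩ | ⟨u', f₂, e₁, s2, h2, h2'⟩
        · exact .inl ⟨rfl, h1.trans h2⟩
        · exact .inr ⟨u', f₂, e₁, s2, h1.trans h2, h2'⟩
      · rcases ih2 (hl ▸ hn) rfl rfl with ⟨rfl, h2⟩ | ⟨u', e₁, f₂, s2, h2, h2'⟩
        · exact .inr ⟨u, f₁, d₁, s1, h1, h2.symm.trans h1'⟩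
        -- Both halves end in a square containing the middle letter `f`. The tails of the middle
        -- word are shorter, so they agree in their last letter, and the two squares coincide, or
        -- they supply the third square of a cube.
        · rcases ih (h1'.symm.trans h2) (h1'.length_eq ▸ hw) rfl rfl with
            ⟨rfl, h3⟩ | ⟨t, e₂, d₂, s3, h3, h3'⟩
          · obtain ⟨rfl, rfl⟩ := S.unique (S.symm s1) s2
            exact .inl ⟨rfl, h1.trans ((Eqv.cons _ h3).trans h2'.symm)⟩
          · obtain ⟨f₃, e₃, d₃, c1, c2, c3⟩ := S.cube s3 (S.symm s1) s2
            exact .inr ⟨f₃ :: t, e₃, d₃, c3,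
              h1.trans ((Eqv.cons _ h3).trans (.swap t c1)),
              h2'.trans ((Eqv.cons _ h3').trans (.swap t c2))⟩

theorem Eqv.lcm {d e : T} {w w' : List T} (h : S.Eqv (d :: w) (e :: w')) : S.Lcm d e w w' :=
  Lcm.of_eqv_aux _ h le_rfl rfl rfl

theorem Eqv.of_cons {d : T} {w w' : List T} (h : S.Eqv (d :: w) (d :: w')) : S.Eqv w w' := by
  rcases h.lcm with ⟨-, h⟩ | ⟨t, f, g, h, -⟩
  · exact h
  · exact absurd rfl (S.last_ne h)

/-- Reduced words. -/
def Red (S : SquareSystem T) : List T → Prop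
  | [] => True
  | d :: w => Red S w ∧ ∀ u, ¬ S.Eqv w (S.rev d :: u)

/-- A cancellation that becomes visible after a square exchange was already possible before it,
because the square can be rotated and the exchange undone across it. -/
theorem Red.congr {u v : List T} (hu : S.Red u) (h : S.Eqv u v) : S.Red v := by
  induction hn : u.length using Nat.strong_induction_on generalizing u v with
  | _ n ih =>
    subst hn
    have hl := h.length_eq
    match u, v, hl with
    | [], [], _ => exact hu
    | d :: w, e :: w', hl =>
    have hlw : w.length < (d :: w).length := by simp
    rcases h.lcm with ⟨rfl, h1⟩ | ⟨t, f, g, s, h1, h2⟩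
    · exact ⟨ih _ hlw hu.1 h1 rfl, fun u h3 => hu.2 u (h1.trans h3)⟩
    · obtain ⟨ht, hf⟩ := ih _ hlw hu.1 h1 rfl
      have hg : S.Red (g :: t) := by
        refine ⟨ht, fun r hr => hu.2 (e :: r) ?_⟩
        exact h1.trans ((Eqv.cons f hr).trans (.swap r (S.rot (S.symm s))))
      have hlw' : (g :: t).length < (d :: w).length := by
        have := h2.length_eq
        simp only [List.length_cons] at this hl ⊢
        omega
      refine ⟨ih _ hlw' hg h2.symm rfl, fun r hr => ?_⟩
      rcases (h2.symm.trans hr).lcm with ⟨h3, -⟩ | ⟨q, a, b, s', h3, -⟩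
      · exact S.ne_rev (S.symm s) (by rw [h3, S.rev_rev])
      · have h4 := S.rot' s'
        rw [S.rev_rev] at h4
        obtain ⟨h5, -⟩ := S.unique (S.symm s) h4
        exact hf q (by rw [h5, S.rev_rev]; exact h3)

open Classical in
/-- Append a letter to a reduced word. -/
noncomputable def app (S : SquareSystem T) (w : List T) (d : T) : List T :=
  if h : ∃ u, S.Eqv w (S.rev d :: u) then h.choose else d :: w

theorem app_of_eqv {w u : List T} {d : T} (h : S.Eqv w (S.rev d :: u)) :
    S.Eqv (S.app w d) u := by
  have h' : ∃ u, S.Eqv w (S.rev d :: u) := ⟨u, h⟩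
  rw [app, dif_pos h']
  exact (h'.choose_spec.symm.trans h).of_cons

theorem app_of_not {w : List T} {d : T} (h : ∀ u, ¬ S.Eqv w (S.rev d :: u)) :
    S.app w d = d :: w := by
  rw [app, dif_neg (not_exists.2 h)]

theorem app_congr {w w' : List T} (h : S.Eqv w w') (d : T) : S.Eqv (S.app w d) (S.app w' d) := by
  by_cases h1 : ∃ u, S.Eqv w' (S.rev d :: u)
  · obtain ⟨u, hu⟩ := h1
    exact (app_of_eqv (h.trans hu)).trans (app_of_eqv hu).symm
  · rw [not_exists] at h1
    rw [app_of_not h1, app_of_not fun u hu => h1 u (h.symm.trans hu)]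
    exact h.cons d

theorem Red.app {w : List T} (h : S.Red w) (d : T) : S.Red (S.app w d) := by
  by_cases h1 : ∃ u, S.Eqv w (S.rev d :: u)
  · obtain ⟨u, hu⟩ := h1
    exact (h.congr hu).1.congr (app_of_eqv hu).symm
  · rw [not_exists] at h1
    rw [app_of_not h1]
    exact ⟨h, h1⟩

theorem app_rev {w : List T} (h : S.Red w) (d : T) :
    S.Eqv (S.app (S.app w d) (S.rev d)) w := by
  by_cases h1 : ∃ u, S.Eqv w (S.rev d :: u)
  · obtain ⟨u, hu⟩ := h1
    refine (app_congr (app_of_eqv hu) _).trans ?_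
    rw [app_of_not (h.congr hu).2]
    exact hu.symm
  · rw [not_exists] at h1
    rw [app_of_not h1]
    exact app_of_eqv (by rw [S.rev_rev]; exact .refl _)

/-- Together with `app_rev`, this makes appending letters an action of homotopy classes of paths on
classes of reduced words. -/
theorem app_app_of_sw {w : List T} (h : S.Red w) {d e a b : T} (s : S.sw d e a b) :
    S.Eqv (S.app (S.app w d) e) (S.app (S.app w a) b) := by
  -- If only `d` cancels, moving `a` across the rotated square shows that `b` cancels after `a`,
  -- leaving the same word.
  have mixed : ∀ {d e a b u}, S.sw d e a b → S.Eqv w (S.rev d :: u) →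
      (∀ u, ¬ S.Eqv w (S.rev a :: u)) →
      S.Eqv (S.app (S.app w d) e) (S.app (S.app w a) b) := by
    intro d e a b u s hu ha
    have h1 : S.Eqv (a :: w) (S.rev b :: e :: u) :=
      (Eqv.cons a hu).trans (.swap u (S.rot s))
    have h2 : S.Red (S.rev b :: e :: u) := Red.congr (u := a :: w) ⟨h, ha⟩ h1
    rw [app_of_not ha]
    refine (app_congr (app_of_eqv hu) e).trans ?_
    rw [app_of_not h2.1.2]
    exact (app_of_eqv h1).symm
  -- If neither `d` nor `a` cancels, then `e` cannot cancel after `d`: the square needed for this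
  -- would be the given one, and `a` would cancel.
  have free : ∀ {d e a b}, S.sw d e a b → (∀ u, ¬ S.Eqv w (S.rev d :: u)) →
      (∀ u, ¬ S.Eqv w (S.rev a :: u)) → S.app (S.app w d) e = e :: d :: w := by
    intro d e a b s hd ha
    rw [app_of_not hd, app_of_not]
    intro u hu
    rcases hu.lcm with ⟨h3, -⟩ | ⟨t, f, g, s', h3, -⟩
    · exact S.ne_rev s (by rw [h3, S.rev_rev])
    · have h4 := S.rot' s'
      rw [S.rev_rev] at h4
      obtain ⟨h5, -⟩ := S.unique s h4
      exact ha t (by rw [h5, S.rev_rev]; exact h3)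
  by_cases h1 : ∃ u, S.Eqv w (S.rev d :: u)
  · obtain ⟨u, hu⟩ := h1
    by_cases h2 : ∃ u, S.Eqv w (S.rev a :: u)
    · obtain ⟨v, hv⟩ := h2
      rcases (hu.symm.trans hv).lcm with ⟨h3, -⟩ | ⟨t, f, g, s', h3, h4⟩
      · exact absurd (by rw [← S.rev_rev d, h3, S.rev_rev]) (S.first_ne s)
      -- If both cancel, the word ends in the reversed square, and both paths remove two letters and
      -- leave `t`.
      · obtain ⟨rfl, rfl⟩ := S.unique_left s' (S.rot (S.symm (S.rot s)))
        exact ((app_congr (app_of_eqv hu) e).trans (app_of_eqv h3)).trans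
          ((app_congr (app_of_eqv hv) b).trans (app_of_eqv h4)).symm
    · exact mixed s hu (not_exists.1 h2)
  · by_cases h2 : ∃ u, S.Eqv w (S.rev a :: u)
    · obtain ⟨v, hv⟩ := h2
      exact (mixed (S.symm s) hv (not_exists.1 h1)).symm
    · rw [not_exists] at h1 h2
      rw [free s h1 h2, free (S.symm s) h2 h1]
      exact .swap w s

theorem foldl_congr (p : List T) {w w' : List T} (h : S.Eqv w w') :
    S.Eqv (p.foldl S.app w) (p.foldl S.app w') := by
  induction p generalizing w w' with
  | nil => exact h
  | cons d p ih => exact ih (app_congr h d)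

theorem Red.foldl (p : List T) {w : List T} (h : S.Red w) : S.Red (p.foldl S.app w) := by
  induction p generalizing w with
  | nil => exact h
  | cons d p ih => exact ih (h.app d)

theorem foldl_reverse (p : List T) {w : List T} (h : S.Red w) :
    S.Eqv (p.foldl S.app ((p.map S.rev).reverse.foldl S.app w)) w := by
  induction p generalizing w with
  | nil => exact .refl _
  | cons d p ih =>
    simp only [List.map_cons, List.reverse_cons, List.foldl_append, List.foldl_cons, List.foldl_nil]
    have := app_rev (h.foldl (p.map S.rev).reverse) (S.rev d)
    rw [S.rev_rev] at this
    exact (foldl_congr p this).trans (ih h)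

/-- Two paths which act in the same way on reduced words. -/
def Same (S : SquareSystem T) (p q : List T) : Prop :=
  ∀ w, S.Red w → S.Eqv (p.foldl S.app w) (q.foldl S.app w)

/-- Paths act invertibly up to equivalence (`foldl_reverse`), so every reduced word is reached by
`p`. -/
theorem Same.cancel_left {p q r : List T} (h : S.Same (p ++ q) (p ++ r)) :
    S.Same q r := by
  intro w hw
  have h1 := h _ (hw.foldl (p.map S.rev).reverse)
  simp only [List.foldl_append] at h1
  exact (foldl_congr q (foldl_reverse p hw)).symm.trans
    (h1.trans (foldl_congr r (foldl_reverse p hw)))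

/-- Two sides of a closed path of length four without backtracks are the sides of a square. -/
theorem Same.sw_of_pair {d e a b : T} (h : S.Same [d, e] [a, b]) (h1 : e ≠ S.rev d)
    (h2 : b ≠ S.rev a) (h3 : d ≠ a) : S.sw d e a b := by
  have h4 := h [] trivial
  have key : ∀ d, S.app [] d = [d] := fun d => app_of_not fun u hu => by simpa using hu.length_eq
  have single : ∀ {x y : T} {t : List T}, S.Eqv [x] (y :: t) → x = y ∧ t = [] := by
    intro x y t ht
    have ht' : t = [] := by simpa using ht.length_eq
    subst ht'
    rcases ht.lcm with ⟨h, -⟩ | ⟨t, f, g, -, h, -⟩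
    · exact ⟨h, rfl⟩
    · simpa using h.length_eq
  have key2 : ∀ {d e}, e ≠ S.rev d → S.app [d] e = [e, d] := fun {d e} hde =>
    app_of_not fun u hu => hde (by rw [(single hu).1, S.rev_rev])
  simp only [List.foldl_cons, List.foldl_nil, key, key2 h1, key2 h2] at h4
  rcases h4.lcm with ⟨-, h5⟩ | ⟨t, f, g, s, h5, h6⟩
  · exact absurd (single h5).1 h3
  · obtain ⟨rfl, -⟩ := single h5
    obtain ⟨rfl, -⟩ := single h6
    exact s

end SquareSystem

/-! ### Cells of $X$: sheet invariants and flag links -/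

/-- Two marked `3`-cubes have the same face with directions `I` at the marked corner. -/
def Sim (M : Monodromy) (I : Set (Fin 3)) (x y : Flag) : Prop :=
  (Quot.mk _ x : MarkedCell M I) = Quot.mk _ y

section

variable {M : Monodromy} {I J : Set (Fin 3)} {x y z : Flag}

theorem Sim.symm (h : Sim M I x y) : Sim M I y x := Eq.symm h

theorem Sim.trans (h : Sim M I x y) (h' : Sim M I y z) : Sim M I x z := Eq.trans h h'

theorem Sim.cross {j : Fin 3} (hj : j ∉ I) (c : Fin 4) (x : Flag) : Sim M I x (x.cross M j c) :=
  Quot.sound ⟨j, hj, c, rfl⟩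

theorem Sim.inv {γ : Type*} (f : Flag → γ)
    (hf : ∀ x (j : Fin 3) c, j ∉ I → f (x.cross M j c) = f x) (h : Sim M I x y) : f x = f y :=
  congrArg (Quot.lift f (by rintro _ _ ⟨_, hj, _, rfl⟩; exact (hf _ _ _ hj).symm)) h

theorem Sim.mono (hIJ : I ⊆ J) (h : Sim M J x y) : Sim M I x y :=
  h.inv (fun x => (Quot.mk _ x : MarkedCell M I))
    fun _ _ _ hj => (Sim.cross (fun hi => hj (hIJ hi)) _ _).symm

theorem Sim.flip {k : Fin 3} (hk : k ∈ I) (h : Sim M I x y) : Sim M I (x.flip k) (y.flip k) := by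
  refine h.inv (fun x => (Quot.mk _ (x.flip k) : MarkedCell M I)) fun x j c hj => ?_
  have hjk : j ≠ k := fun e => hj (e ▸ hk)
  rw [x.cross_flip M hjk c]
  exact (Sim.cross hj c _).symm

theorem Sim.v_eq (h : Sim M I x y) : x.v = y.v := h.inv Flag.v fun _ _ _ _ => rfl

theorem Sim.e_eq {k : Fin 3} (hk : k ∈ I) (h : Sim M I x y) : x.e k = y.e k :=
  h.inv (fun x => x.e k) fun _ _ _ hj =>
    Function.update_of_ne (fun e => hj (e ▸ hk)) _ _

end

/-- The sheet, normalised so as not to depend on the edge in direction `i + 2`. -/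
def Flag.nb (M : Monodromy) (i : Fin 3) (x : Flag) : Fin 5 :=
  if x.v (i + 2) = true then (M.β i (x.e (i + 2)))⁻¹ (x.s i) else x.s i

/-- The sheet, normalised so as not to depend on the edge in direction `i + 1`. -/
def Flag.na (M : Monodromy) (i : Fin 3) (x : Flag) : Fin 5 :=
  if x.v (i + 1) = false then (M.α i (x.e (i + 1)))⁻¹ (x.s i) else x.s i

/-- The sheet at an unramified corner, normalised so as not to depend on the edges. -/
def Flag.nn (M : Monodromy) (i : Fin 3) (x : Flag) : Fin 5 :=
  if x.v (i + 1) = false then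
    if x.v (i + 2) = true then 0 else (M.α i (x.e (i + 1)))⁻¹ (x.s i)
  else if x.v (i + 2) = true then (M.β i (x.e (i + 2)))⁻¹ (x.s i) else x.s i

theorem Flag.nb_cross (M : Monodromy) {i j : Fin 3} (hj : j ≠ i + 1) (c : Fin 4) (x : Flag) :
    (x.cross M j c).nb M i = x.nb M i := by
  simp only [Flag.nb, Flag.cross]
  by_cases h : i + 2 = j
  · subst h
    by_cases hv : x.v (i + 2) = true <;> simp [hv]
  · simp [h, Ne.symm hj]

theorem Flag.na_cross (M : Monodromy) {i j : Fin 3} (hj : j ≠ i + 2) (c : Fin 4) (x : Flag) :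
    (x.cross M j c).na M i = x.na M i := by
  simp only [Flag.na, Flag.cross]
  by_cases h : i + 1 = j
  · subst h
    by_cases hv : x.v (i + 1) = false <;> simp [hv]
  · simp [h, Ne.symm hj]

/-- Away from the `i`-th component of $L$, at most one of the families `α i`, `β i` acts at the
corner. At a corner over that component both act, and there the default value `0` makes the claim
trivial. -/
theorem Flag.nn_cross (M : Monodromy) (i j : Fin 3) (c : Fin 4) (x : Flag) :
    (x.cross M j c).nn M i = x.nn M i := by
  have h12 : i + 1 ≠ i + 2 := by revert i; decide
  simp only [Flag.nn, Flag.cross]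
  by_cases h : i + 1 = j
  · subst h
    rcases Bool.eq_false_or_eq_true (x.v (i + 1)) with hv | hv <;>
      rcases Bool.eq_false_or_eq_true (x.v (i + 2)) with hv' | hv' <;>
      simp [hv, hv', h12.symm]
  · by_cases h' : i + 2 = j
    · subst h'
      rcases Bool.eq_false_or_eq_true (x.v (i + 1)) with hv | hv <;>
        rcases Bool.eq_false_or_eq_true (x.v (i + 2)) with hv' | hv' <;>
        simp [hv, hv', h12]
    · simp [h, h']

section

variable {M : Monodromy} {x y z : Flag} {i k l m : Fin 3}

theorem Sim.nb_eq (h : Sim M {i + 1} x y) : x.nb M i = y.nb M i :=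
  h.inv (Flag.nb M i) fun x _ c hj => x.nb_cross M hj c

theorem Sim.na_eq (h : Sim M {i + 2} x y) : x.na M i = y.na M i :=
  h.inv (Flag.na M i) fun x _ c hj => x.na_cross M hj c

/-- An edge in direction `k ≠ i` leaves only one of the two families acting on the `i`-th sheet, so
`nb` or `na` recovers the sheet from the labels. For `k = i` the edge may be ramified and this
fails. -/
theorem Sim.s_eq (hk : k ≠ i) (h : Sim M {k} x y) (he : x.e = y.e) : x.s i = y.s i := by
  have hv := h.v_eq
  have hk' : k = i + 1 ∨ k = i + 2 := by
    clear h hv he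
    revert i k
    decide
  rcases hk' with rfl | rfl
  · have := h.nb_eq
    simp only [Flag.nb, he, hv] at this
    split_ifs at this
    · exact (M.β i _)⁻¹.injective this
    · exact this
  · have := h.na_eq
    simp only [Flag.na, he, hv] at this
    split_ifs at this
    · exact (M.α i _)⁻¹.injective this
    · exact this

/-- Two edges at a vertex of `X` span at most one square. -/
theorem Sim.pair (hkl : k ≠ l) (h : Sim M {k} x y) (h' : Sim M {l} x y) : Sim M {k, l} x y := by
  obtain ⟨m, hmk, hml, hm⟩ : ∃ m : Fin 3, m ≠ k ∧ m ≠ l ∧ ∀ j, j = m ∨ j = k ∨ j = l := by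
    clear h h'
    revert k l
    decide
  have hm' : m ∉ ({k, l} : Set (Fin 3)) := by simp [hmk, hml]
  -- Crossing the square itself adjusts the third label. The cubes then have equal labels, and each
  -- sheet component is read off at whichever of the two edges is not parallel to it.
  have h1 := Sim.cross (M := M) (I := {k, l}) hm' (y.e m) x
  have h2 := (h1.mono (by simp)).symm.trans h
  have h3 := (h1.mono (by simp)).symm.trans h'
  have he : (x.cross M m (y.e m)).e = y.e := by
    funext j
    rcases hm j with rfl | rfl | rfl
    · simp [Flag.cross]
    · exact h2.e_eq (by simp)
    · exact h3.e_eq (by simp)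
  have hxy : x.cross M m (y.e m) = y := by
    refine Flag.ext he (funext fun i => ?_) h.v_eq
    by_cases hi : k = i
    · exact h3.s_eq (by rw [← hi]; exact hkl.symm) he
    · exact h2.s_eq hi he
  exact hxy ▸ h1

/-- The links of the vertices of `X` are flag complexes. -/
theorem Sim.exists_cube (hkl : k ≠ l) (hlm : l ≠ m) (hkm : k ≠ m) (hxy : Sim M {l} x y)
    (hxz : Sim M {k} x z) (hyz : Sim M {m} y z) :
    ∃ w, Sim M {k, l} w x ∧ Sim M {l, m} w y ∧ Sim M {k, m} w z := by
  have hall : ∀ j, j = k ∨ j = l ∨ j = m := by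
    clear hxy hxz hyz
    revert k l m
    decide
  -- Each square is crossed so that its cube acquires the one label that its square does not
  -- prescribe. The three resulting cubes coincide.
  have h1 := Sim.cross (M := M) (I := {k, l}) (j := m) (by simp [hkm.symm, hlm.symm]) (y.e m) x
  have h2 := Sim.cross (M := M) (I := {l, m}) (j := k) (by simp [hkm, hkl]) (x.e k) y
  have h3 := Sim.cross (M := M) (I := {k, m}) (j := l) (by simp [hkl.symm, hlm]) (x.e l) z
  have h4 := (h1.symm.mono (I := {l}) (by simp)).trans (hxy.trans (h2.mono (by simp)))
  have h5 := (h1.symm.mono (I := {k}) (by simp)).trans (hxz.trans (h3.mono (by simp)))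
  have h6 := (h2.symm.mono (I := {m}) (by simp)).trans (hyz.trans (h3.mono (by simp)))
  have e1 : (x.cross M m (y.e m)).e = (y.cross M k (x.e k)).e := by
    funext j
    rcases hall j with rfl | rfl | rfl
    · simp [Flag.cross, hkm]
    · exact h4.e_eq (by simp)
    · simp [Flag.cross, hkm.symm]
  have e2 : (x.cross M m (y.e m)).e = (z.cross M l (x.e l)).e := by
    funext j
    rcases hall j with rfl | rfl | rfl
    · exact h5.e_eq (by simp)
    · simp [Flag.cross, hlm]
    · rw [congrFun e1]
      exact h6.e_eq (by simp)
  have s1 : ∀ i, (x.cross M m (y.e m)).s i = (y.cross M k (x.e k)).s i ∧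
      (x.cross M m (y.e m)).s i = (z.cross M l (x.e l)).s i := by
    intro i
    have e3 := e1.symm.trans e2
    rcases hall i with rfl | rfl | rfl
    · have := h4.s_eq hkl.symm e1
      exact ⟨this, this.trans (h6.s_eq hkm.symm e3)⟩
    · have := h5.s_eq hkl e2
      exact ⟨this.trans (h6.s_eq hlm.symm e3).symm, this⟩
    · exact ⟨h4.s_eq hlm e1, h5.s_eq hkm e2⟩
  have w1 : x.cross M m (y.e m) = y.cross M k (x.e k) :=
    Flag.ext e1 (funext fun i => (s1 i).1) h4.v_eq
  have w2 : x.cross M m (y.e m) = z.cross M l (x.e l) :=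
    Flag.ext e2 (funext fun i => (s1 i).2) h5.v_eq
  exact ⟨_, h1.symm, w1 ▸ h2.symm, w2 ▸ h3.symm⟩

theorem Dart.mk_eq_mk {x y : Flag} : Dart.mk M k x = Dart.mk M l y ↔ k = l ∧ Sim M {k} x y := by
  constructor
  · intro h
    have hkl : k = l := congrArg Sigma.fst h
    subst hkl
    exact ⟨rfl, eq_of_heq (Sigma.mk.inj_iff.1 h).2⟩
  · rintro ⟨rfl, h⟩
    exact congrArg (Sigma.mk k) h

end

/-! ### The squares of $X$ as a square system -/

/-- The darts `d, e` and `a, b` lead around a square of `X` from a corner to the opposite one. -/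
def Dart.Sw {M : Monodromy} (d e a b : Dart M) : Prop :=
  ∃ x k l, k ≠ l ∧ d = Dart.mk M k x ∧ e = Dart.mk M l (x.flip k) ∧ a = Dart.mk M l x ∧
    b = Dart.mk M k (x.flip l)

/-- The squares of `X`. -/
def squareSystem (M : Monodromy) : SquareSystem (Dart M) where
  rev := Dart.rev
  sw := Dart.Sw
  rev_rev := Dart.rev_rev
  symm := by
    rintro _ _ _ _ ⟨x, k, l, h, rfl, rfl, rfl, rfl⟩
    exact ⟨x, l, k, h.symm, rfl, rfl, rfl, rfl⟩
  rot := by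
    rintro _ _ _ _ ⟨x, k, l, h, rfl, rfl, rfl, rfl⟩
    exact ⟨x.flip k, k, l, h, rfl, by rw [Flag.flip_flip], rfl, by rw [Dart.rev_mk, Flag.flip_comm]⟩
  unique := by
    rintro _ _ _ _ _ _ ⟨x, k, l, h, rfl, rfl, rfl, rfl⟩ ⟨y, k', l', -, h1, h2, rfl, rfl⟩
    obtain ⟨rfl, h3⟩ := Dart.mk_eq_mk.1 h1
    obtain ⟨rfl, h4⟩ := Dart.mk_eq_mk.1 h2
    have h5 := ((h3.flip (k := k) (by simp)).pair h h4).flip (k := k) (by simp)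
    rw [Flag.flip_flip, Flag.flip_flip] at h5
    exact ⟨Dart.mk_eq_mk.2 ⟨rfl, h5.mono (by simp)⟩,
      Dart.mk_eq_mk.2 ⟨rfl, (h5.flip (k := l) (by simp)).mono (by simp)⟩⟩
  ne_rev := by
    rintro _ _ _ _ ⟨x, k, l, h, rfl, rfl, rfl, rfl⟩ h'
    exact h (congrArg Sigma.fst h').symm
  cube := by
    rintro _ _ _ _ _ _ _ _ _ ⟨x, k, l, hkl, rfl, rfl, rfl, rfl⟩
      ⟨y, l', m, hlm, h1, rfl, rfl, rfl⟩ ⟨z, k', m', hkm, h2, h3, rfl, rfl⟩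
    obtain ⟨rfl, h4⟩ := Dart.mk_eq_mk.1 h1
    obtain ⟨rfl, h5⟩ := Dart.mk_eq_mk.1 h2
    obtain ⟨rfl, h6⟩ := Dart.mk_eq_mk.1 h3
    have h7 := h4.flip (k := l) (by simp)
    have h8 := h5.flip (k := k) (by simp)
    rw [← Flag.flip_comm k l x] at h8
    -- The three squares meet at the corner where `d₁` and `e₁` end and `f` begins. The cube `w` is
    -- marked there, and `x'` is its corner where `e₂` and `d₂` begin.
    obtain ⟨w, w1, w2, w3⟩ := Sim.exists_cube hkl hlm hkm h7 h8 h6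
    replace w1 := (w1.flip (k := l) (by simp)).flip (k := k) (by simp)
    replace w2 := w2.flip (k := l) (by simp)
    replace w3 := w3.flip (k := k) (by simp)
    rw [Flag.flip_flip, Flag.flip_flip] at w1
    rw [Flag.flip_flip] at w2 w3
    obtain ⟨x', hx'⟩ : ∃ x', x' = (w.flip l).flip k := ⟨_, rfl⟩
    have hk : x'.flip k = w.flip l := by rw [hx', Flag.flip_flip]
    have hl : x'.flip l = w.flip k := by rw [hx', ← Flag.flip_comm k l, Flag.flip_flip]
    rw [← hx'] at w1
    rw [← hk] at w2
    rw [← hl] at w3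
    refine ⟨Dart.mk M m x', Dart.mk M k (x'.flip m), Dart.mk M l (x'.flip m),
      ⟨x', k, m, hkm, ?_, ?_, rfl, rfl⟩, ⟨x', l, m, hlm, ?_, ?_, rfl, rfl⟩,
      ⟨x'.flip m, k, l, hkl, rfl, ?_, rfl, ?_⟩⟩ <;>
      refine Dart.mk_eq_mk.2 ⟨rfl, Sim.symm ?_⟩
    · exact w1.mono (by simp)
    · exact w2.mono (by simp)
    · exact w1.mono (by simp)
    · exact w3.mono (by simp)
    · rw [Flag.flip_comm]
      exact (w2.flip (k := m) (by simp)).mono (by simp)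
    · rw [Flag.flip_comm]
      exact (w3.flip (k := m) (by simp)).mono (by simp)

/-! ### Homotopy of edge paths and lifts to the universal cover -/

namespace SquareSystem

variable {T : Type*} {S : SquareSystem T}

theorem Same.refl (p : List T) : S.Same p p := fun _ _ => .refl _

theorem Same.symm {p q : List T} (h : S.Same p q) : S.Same q p := fun w hw => (h w hw).symm

theorem Same.trans {p q r : List T} (h : S.Same p q) (h' : S.Same q r) : S.Same p r :=
  fun w hw => (h w hw).trans (h' w hw)

theorem Same.insert {r : List T} (h : S.Same r []) (u w : List T) :
    S.Same (u ++ r ++ w) (u ++ w) := by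
  intro v hv
  simp only [List.foldl_append]
  exact foldl_congr w (h _ (hv.foldl u))

theorem same_backtrack (d : T) : S.Same [d, S.rev d] [] := fun _ hw => app_rev hw d

theorem same_square {d e a b : T} (h : S.sw d e a b) :
    S.Same [d, e, S.rev b, S.rev a] [] := by
  intro w hw
  simp only [List.foldl_cons, List.foldl_nil]
  refine (app_congr (app_congr (app_app_of_sw hw h) _) _).trans ?_
  exact (app_congr (app_rev (hw.app a) b) _).trans (app_rev hw a)

end SquareSystem

section

variable {M : Monodromy} {x₀ : Vertex M}

theorem Step.same {p q : List (Dart M)} (h : Step p q) : (squareSystem M).Same p q := by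
  cases h with
  | backtrack u d w => exact (SquareSystem.same_backtrack (S := squareSystem M) d).insert u w
  | square u x k l h w =>
    refine SquareSystem.Same.insert ?_ u w
    have hs : (squareSystem M).sw (Dart.mk M k x) (Dart.mk M l (x.flip k)) (Dart.mk M l x)
        (Dart.mk M k (x.flip l)) := ⟨x, k, l, h, rfl, rfl, rfl, rfl⟩
    convert SquareSystem.same_square hs using 1
    change _ = [_, _, Dart.mk M k ((x.flip l).flip k), Dart.mk M l (x.flip l)]
    rw [Flag.flip_comm]
    rfl

theorem Cover.same_of_eq {p q : PathFrom x₀} (h : (Quot.mk _ p : Cover x₀) = Quot.mk _ q) :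
    (squareSystem M).Same p.1 q.1 := by
  replace h := Quot.eqvGen_exact h
  induction h with
  | rel _ _ h => exact h.same
  | refl _ => exact .refl _
  | symm _ _ _ ih => exact ih.symm
  | trans _ _ _ _ _ h1 h2 => exact h1.trans h2

theorem Step.append {p q : List (Dart M)} (h : Step p q) (r : List (Dart M)) :
    Step (p ++ r) (q ++ r) := by
  cases h with
  | backtrack u d w => simpa using Step.backtrack u d (w ++ r)
  | square u x k l h w => simpa using Step.square u x k l h (w ++ r)

/-- Makes the lift of an edge independent of the path that represents its initial vertex. -/
theorem Cover.append_eq {p q : PathFrom x₀} (h : (Quot.mk _ p : Cover x₀) = Quot.mk _ q)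
    {r : List (Dart M)} (hp : IsPath x₀ (p.1 ++ r)) :
    ∃ hq : IsPath x₀ (q.1 ++ r),
      (Quot.mk _ ⟨p.1 ++ r, hp⟩ : Cover x₀) = Quot.mk _ ⟨q.1 ++ r, hq⟩ := by
  have he : endpoint x₀ p.1 = endpoint x₀ q.1 := congrArg Cover.proj h
  have hq : ∀ q : PathFrom x₀, endpoint x₀ p.1 = endpoint x₀ q.1 → IsPath x₀ (q.1 ++ r) :=
    fun q he => (isPath_append _ _ _).2 ⟨q.2, he ▸ ((isPath_append _ _ _).1 hp).2⟩
  refine ⟨hq q he, ?_⟩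
  -- The endpoint equalities are quantified so that the intermediate paths of the generated
  -- equivalence can also be prolonged by `r`.
  have key : ∀ (p' q' : PathFrom x₀), Relation.EqvGen (fun p q : PathFrom x₀ => Step p.1 q.1) p' q' →
      ∀ (h1 : endpoint x₀ p.1 = endpoint x₀ p'.1) (h2 : endpoint x₀ p.1 = endpoint x₀ q'.1),
      (Quot.mk _ ⟨p'.1 ++ r, hq p' h1⟩ : Cover x₀) = Quot.mk _ ⟨q'.1 ++ r, hq q' h2⟩ := by
    intro p' q' h
    induction h with
    | rel _ _ h => exact fun _ _ => Quot.sound (h.append r)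
    | refl _ => exact fun _ _ => rfl
    | symm _ _ _ ih => exact fun h1 h2 => (ih h2 h1).symm
    | trans x y z hxy _ ih1 ih2 =>
      intro h1 h2
      have h3 : endpoint x₀ x.1 = endpoint x₀ y.1 := congrArg Cover.proj (Quot.eqvGen_sound hxy)
      exact (ih1 h1 (h1.trans h3)).trans (ih2 (h1.trans h3) h2)
  exact key p q (Quot.eqvGen_exact h) rfl he

/-- The oriented edge from `a` to `b` of the universal cover lies over `d`. -/
def IsLift (d : Dart M) (a b : Cover x₀) : Prop :=
  ∃ (p : PathFrom x₀) (h : IsPath x₀ (p.1 ++ [d])), a = Quot.mk _ p ∧ b = Quot.mk _ ⟨p.1 ++ [d], h⟩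

theorem edge_iff {P : Dart M → Prop} {a b : Cover x₀} :
    Cover.Edge P a b ↔ ∃ d, P d ∧ IsLift d a b := by
  constructor
  · rintro ⟨p, d, h, hd, h1, h2⟩
    exact ⟨d, hd, p, h, h1, h2⟩
  · rintro ⟨d, hd, p, h, h1, h2⟩
    exact ⟨p, d, h, hd, h1, h2⟩

theorem isLift_iff {d : Dart M} {a b : Cover x₀} : IsLift d a b ↔ Cover.Edge (· = d) a b := by
  simp [edge_iff]

variable {d e d' e' : Dart M} {a b c b' : Cover x₀}

theorem IsLift.of_rep (h : IsLift d a b) {p : PathFrom x₀} (hp : a = Quot.mk _ p) :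
    ∃ h : IsPath x₀ (p.1 ++ [d]), b = Quot.mk _ ⟨p.1 ++ [d], h⟩ := by
  obtain ⟨q, hq, h1, rfl⟩ := h
  exact Cover.append_eq (h1.symm.trans hp) hq

theorem IsLift.src_eq (h : IsLift d a b) : d.src = a.proj := by
  obtain ⟨_, rfl, h1, -⟩ := (isLift_iff.1 h).exists_dart
  exact h1

theorem IsLift.tgt_eq (h : IsLift d a b) : d.tgt = b.proj := by
  obtain ⟨_, rfl, -, h1⟩ := (isLift_iff.1 h).exists_dart
  exact h1

theorem IsLift.exists (h : d.src = a.proj) : ∃ b, IsLift d a b := by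
  obtain ⟨p, rfl⟩ := Quot.exists_rep a
  exact ⟨_, p, (isPath_append _ _ _).2 ⟨p.2, h, trivial⟩, rfl, rfl⟩

theorem IsLift.rev (h : IsLift d a b) : IsLift d.rev b a := by
  obtain ⟨p, hp, rfl, rfl⟩ := h
  have hq : IsPath x₀ ((p.1 ++ [d]) ++ [d.rev]) :=
    (isPath_append _ _ _).2 ⟨hp, by rw [endpoint_append]; exact ⟨rfl, trivial⟩⟩
  refine ⟨⟨p.1 ++ [d], hp⟩, hq, rfl, (Quot.sound ?_).symm⟩
  simpa using Step.backtrack p.1 d []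

theorem IsLift.tgt_unique (h : IsLift d a b) (h' : IsLift d a c) : b = c := by
  obtain ⟨p, hp, rfl, rfl⟩ := h
  obtain ⟨_, rfl⟩ := h'.of_rep rfl
  rfl

/-- Every `4`-cycle in the `1`-skeleton of the universal cover is the boundary of a square. -/
theorem IsLift.sw (h1 : IsLift d a b) (h2 : IsLift e b c) (h3 : IsLift d' a b')
    (h4 : IsLift e' b' c) (hac : a ≠ c) (hbb : b ≠ b') : Dart.Sw d e d' e' := by
  have hde : e ≠ d.rev := by
    rintro rfl
    exact hac (h1.rev.tgt_unique h2)
  have hde' : e' ≠ d'.rev := by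
    rintro rfl
    exact hac (h3.rev.tgt_unique h4)
  have hdd : d ≠ d' := by
    rintro rfl
    exact hbb (h1.tgt_unique h3)
  obtain ⟨p, hp, rfl, rfl⟩ := h1
  obtain ⟨_, rfl⟩ := h2.of_rep rfl
  obtain ⟨_, rfl⟩ := h3.of_rep rfl
  obtain ⟨_, h5⟩ := h4.of_rep rfl
  have h6 := Cover.same_of_eq h5
  simp only [List.append_assoc, List.cons_append, List.nil_append] at h6
  exact h6.cancel_left.sw_of_pair hde hde' hdd

/-- The boundary loop of a square is null-homotopic, so its lift closes up; uniqueness of lifts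
identifies the fourth side. -/
theorem IsLift.of_sw (hs : Dart.Sw d e d' e') (h1 : IsLift d a b) (h2 : IsLift e b c)
    (h3 : IsLift d' a b') : IsLift e' b' c := by
  obtain ⟨x, k, l, h, rfl, rfl, rfl, rfl⟩ := hs
  obtain ⟨c', h4⟩ := IsLift.exists (a := c) (d := (Dart.mk M k (x.flip l)).rev) (by
    rw [← h2.tgt_eq, Dart.rev_mk, Dart.src_mk, Dart.tgt_mk, Flag.flip_comm])
  obtain ⟨a', h5⟩ := IsLift.exists (a := c') (d := (Dart.mk M l x).rev) (by
    rw [← h4.tgt_eq, Dart.rev_mk, Dart.src_mk, Dart.rev_mk, Dart.tgt_mk, Flag.flip_flip])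
  have haa : a' = a := by
    obtain ⟨p, hp, rfl, rfl⟩ := h1
    obtain ⟨_, rfl⟩ := h2.of_rep rfl
    obtain ⟨_, rfl⟩ := h4.of_rep rfl
    obtain ⟨_, rfl⟩ := h5.of_rep rfl
    refine Quot.sound ?_
    have := Step.square p.1 x k l h []
    rw [squareLoop, Flag.flip_comm] at this
    simpa [Dart.rev_mk] using this
  subst haa
  have h6 := h5.rev
  rw [Dart.rev_rev] at h6
  obtain rfl := h6.tgt_unique h3
  have h7 := h4.rev
  rwa [Dart.rev_rev] at h7

end

/-! ### The ramification locus and the links of its components -/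

/-- A corner lies over the component of `L` parallel to the `i`-th factor. -/
def Ram (i : Fin 3) (v : Fin 3 → Bool) : Prop := v (i + 1) = false ∧ v (i + 2) = true

/-- The three copies of $\Theta$ are disjoint: for any two of them, some coordinate would have to be
both $0$ and $1$. -/
theorem Ram.unique {i j : Fin 3} {v : Fin 3 → Bool} (h : Ram i v) (h' : Ram j v) : i = j := by
  have key : ∀ i j : Fin 3, i = j ∨ i + 1 = j + 2 ∨ i + 2 = j + 1 := by decide
  rcases key i j with h1 | h1 | h1
  · exact h1
  · have := h.1
    rw [h1, h'.2] at this
    simp at this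
  · have := h.2
    rw [h1, h'.1] at this
    simp at this

theorem Ram.update {i : Fin 3} {v : Fin 3 → Bool} (h : Ram i v) (b : Bool) :
    Ram i (Function.update v i b) := by
  have h1 : i + 1 ≠ i := by clear h; revert i; decide
  have h2 : i + 2 ≠ i := by clear h; revert i; decide
  exact ⟨(Function.update_of_ne h1 _ _).trans h.1, (Function.update_of_ne h2 _ _).trans h.2⟩

section

variable {M : Monodromy} {x y z : Flag} {i k l : Fin 3}

/-- The corner is not over any other component, so the vertex and the labels determine all sheet
components except the `i`-th. -/
theorem Sim.eq_of_ram (hr : Ram i x.v) (h : Sim M ∅ x y) (he : x.e = y.e) (hs : x.s i = y.s i) :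
    x = y := by
  refine Flag.ext he (funext fun j => ?_) h.v_eq
  by_cases hj : i = j
  · exact hj ▸ hs
  have hv := h.v_eq
  have hn : x.nn M j = y.nn M j := h.inv (Flag.nn M j) fun x _ c _ => x.nn_cross M j _ c
  simp only [Flag.nn, ← he, ← hv] at hn
  split_ifs at hn with h1 h2 h2
  · exact absurd (hr.unique ⟨h1, h2⟩) hj
  · exact (M.α j _)⁻¹.injective hn
  · exact (M.β j _)⁻¹.injective hn
  · exact hn

/-- Two crossings could only interfere on a component `t` of the sheet over which both families act,
which forces `t = i`; but crossing in direction `i` leaves the `i`-th component alone. -/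
theorem Flag.cross_comm (hr : Ram i x.v) {j : Fin 3} (hj : j ≠ i) (c c' : Fin 4) :
    (x.cross M j c').cross M i c = (x.cross M i c).cross M j c' := by
  ext t
  · simp only [Flag.cross]
    rw [Function.update_comm hj.symm]
  · have key : ∀ i j t : Fin 3, j ≠ i → t + 1 ≠ t + 2 ∧ ((t = i ∧ i ≠ t + 1 ∧ i ≠ t + 2) ∨
      (i = t + 1 ∧ j = t + 2) ∨ (i = t + 2 ∧ j = t + 1) ∨ (j = t)) := by decide
    have hne : ¬ Ram t x.v ∨ t = i := by
      by_cases h : Ram t x.v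
      · exact .inr (h.unique hr)
      · exact .inl h
    have h1 : ∀ t : Fin 3, t + 1 ≠ t := by decide
    have h2 : ∀ t : Fin 3, t + 2 ≠ t := by decide
    obtain ⟨h3, ⟨rfl, -⟩ | ⟨rfl, rfl⟩ | ⟨rfl, rfl⟩ | rfl⟩ := key i j t hj
    · simp [Flag.cross, h1, h2, hj]
    · rcases hne with hne | hne
      · rcases Bool.eq_false_or_eq_true (x.v (t + 1)) with hv | hv <;>
          rcases Bool.eq_false_or_eq_true (x.v (t + 2)) with hv' | hv' <;>
          simp_all [Flag.cross, Ram]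
      · exact absurd hne (h1 t).symm
    · rcases hne with hne | hne
      · rcases Bool.eq_false_or_eq_true (x.v (t + 1)) with hv | hv <;>
          rcases Bool.eq_false_or_eq_true (x.v (t + 2)) with hv' | hv' <;>
          simp_all [Flag.cross, Ram]
      · exact absurd hne (h2 t).symm
    · simp [Flag.cross, h1, h2, hj.symm]
  · rfl

/-- At a vertex over `L`, the ramified edges span squares with all the other edges. -/
theorem Sim.exists_span (hr : Ram i x.v) (h : Sim M ∅ x z) (hl : l ≠ i) :
    ∃ w, Sim M {l} w x ∧ Sim M {i} w z := by
  classical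
  -- An edge parallel to $L$ at a vertex over $L$ is determined by its label `c`. The value `none`
  -- elsewhere is there because `Sim.inv` needs a function on all flags.
  have hf : ∀ c : Fin 4, Sim M {i} (x.cross M i c) (z.cross M i c) := by
    intro c
    have := h.inv (fun x => if Ram i x.v then some (Quot.mk _ (x.cross M i c) : MarkedCell M {i})
      else none) fun x j c' _ => by
        change (if Ram i x.v then _ else _) = _
        split_ifs with hr
        · congr 1
          by_cases hj : j = i
          · subst hj
            congr 1
            ext t <;> simp [Flag.cross]
            split_ifs <;> simp
          · rw [Flag.cross_comm hr hj]
            exact (Sim.cross (by simpa using hj) c' _).symm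
        · rfl
    have hz : Ram i z.v := h.v_eq ▸ hr
    simp only [hr, hz, if_true] at this
    exact Option.some.inj this
  have hz : z.cross M i (z.e i) = z := by
    ext t <;> simp [Flag.cross]
  refine ⟨x.cross M i (z.e i), (Sim.cross (by simpa using hl.symm) _ _).symm, ?_⟩
  have := hf (z.e i)
  rwa [hz] at this

end

section

variable {M : Monodromy}

/-- The vertex of the link of the `i`-th component of the ramification locus given by an edge that
is not parallel to this component. -/
def Dart.linkVertex (i : Fin 3) (d : Dart M) : Fin 3 × Fin 4 × Fin 5 :=
  (d.1, Quot.lift (fun x => (x.e d.1,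
      if d.1 = i + 1 then x.nb M i else if d.1 = i + 2 then x.na M i else 0))
    (by
      obtain ⟨k, q⟩ := d
      rintro x y h
      have h : Sim M {k} x y := Quot.sound h
      refine Prod.ext (h.e_eq (Set.mem_singleton k)) ?_
      change (if k = _ then _ else _) = _
      split_ifs with h1 h2
      · exact Sim.nb_eq (i := i) (by rw [← show k = i + 1 from h1]; exact h)
      · exact Sim.na_eq (i := i) (by rw [← show k = i + 2 from h2]; exact h)
      · rfl) d.2)

theorem Dart.linkVertex_mk (i k : Fin 3) (x : Flag) :
    (Dart.mk M k x).linkVertex i =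
      (k, x.e k, if k = i + 1 then x.nb M i else if k = i + 2 then x.na M i else 0) := rfl

/-- Moving along the `i`-th component changes only the `i`-th coordinate of the corner, which `nb`
and `na` do not see. Hence the link is the same all along a ramified segment. -/
theorem Dart.linkVertex_flip (i k : Fin 3) (x : Flag) :
    (Dart.mk M k (x.flip i)).linkVertex i = (Dart.mk M k x).linkVertex i := by
  have h1 : i + 1 ≠ i := by revert i; decide
  have h2 : i + 2 ≠ i := by revert i; decide
  simp [Dart.linkVertex_mk, Flag.nb, Flag.na, Flag.flip, h1, h2]

theorem Dart.linkVertex_add_one {i : Fin 3} {x : Flag} (hr : Ram i x.v) :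
    (Dart.mk M (i + 1) x).linkVertex i =
      (i + 1, x.e (i + 1), (M.β i (x.e (i + 2)))⁻¹ (x.s i)) := by
  simp [Dart.linkVertex_mk, Flag.nb, hr.2]

theorem Dart.linkVertex_add_two {i : Fin 3} {x : Flag} (hr : Ram i x.v) :
    (Dart.mk M (i + 2) x).linkVertex i =
      (i + 2, x.e (i + 2), (M.α i (x.e (i + 1)))⁻¹ (x.s i)) := by
  simp [Dart.linkVertex_mk, Flag.na, hr.1]

/-- Crossing in the two directions other than `k` equalises the labels while keeping the dart. The
source then fixes the sheet except for its `i`-th component, which the link vertex supplies. -/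
theorem Dart.eq_of_linkVertex {i : Fin 3} {d d' : Dart M} (hr : Ram i d.src.corner)
    (hs : d.src = d'.src) (hd : d.1 ≠ i) (h : d.linkVertex i = d'.linkVertex i) : d = d' := by
  obtain ⟨k, x, rfl⟩ := d.exists_mk
  obtain ⟨k', y, rfl⟩ := d'.exists_mk
  obtain rfl : k = k' := congrArg Prod.fst h
  replace hs : Sim M ∅ x y := hs
  replace hr : Ram i x.v := hr
  replace hd : k ≠ i := hd
  have he : x.e k = y.e k := congrArg (fun t => t.2.1) h
  obtain ⟨m, hmk, hmi, hm⟩ : ∃ m : Fin 3, m ≠ k ∧ m ≠ i ∧ ∀ j, j = m ∨ j = k ∨ j = i := by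
    clear h he hr
    revert k i
    decide
  have h1 : Sim M {k} y ((y.cross M m (x.e m)).cross M i (x.e i)) :=
    (Sim.cross (by simpa using hmk) _ _).trans (Sim.cross (by simpa using hd.symm) _ _)
  refine Dart.mk_eq_mk.2 ⟨rfl, Sim.symm (h1.trans (Eq.symm ?_))⟩
  congr 1
  have he' : x.e = ((y.cross M m (x.e m)).cross M i (x.e i)).e := by
    funext j
    rcases hm j with rfl | rfl | rfl
    · simp [Flag.cross, hmi]
    · simp [Flag.cross, hd, hmk.symm, he]
    · simp [Flag.cross]
  refine Sim.eq_of_ram hr (hs.trans (h1.mono (by simp))) he' ?_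
  have h2 : (Dart.mk M k x).linkVertex i =
      (Dart.mk M k ((y.cross M m (x.e m)).cross M i (x.e i))).linkVertex i := by
    rw [h, Dart.mk_eq_mk.2 ⟨rfl, h1⟩]
  have hr' : Ram i ((y.cross M m (x.e m)).cross M i (x.e i)).v := hs.v_eq ▸ hr
  have hk' : k = i + 1 ∨ k = i + 2 := by
    clear * - hd
    revert i k
    decide
  rcases hk' with rfl | rfl
  · rw [Dart.linkVertex_add_one hr, Dart.linkVertex_add_one hr', ← he'] at h2
    exact (M.β i _)⁻¹.injective (congrArg (fun t => t.2.2) h2)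
  · rw [Dart.linkVertex_add_two hr, Dart.linkVertex_add_two hr', ← he'] at h2
    exact (M.α i _)⁻¹.injective (congrArg (fun t => t.2.2) h2)

/-- The four factors of the commutator carry `s₂` to `s₁`, `s₀`, `s₃` and back to `s₂`: this is the
monodromy around a closed $4$-cycle in the link. -/
theorem comm_apply_eq {p p' q q' : Equiv.Perm (Fin 5)} {s₀ s₁ s₂ s₃ : Fin 5}
    (h1 : p⁻¹ s₀ = p'⁻¹ s₁) (h2 : q⁻¹ s₁ = q'⁻¹ s₂) (h3 : p'⁻¹ s₂ = p⁻¹ s₃)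
    (h4 : q'⁻¹ s₃ = q⁻¹ s₀) : comm (p' * p⁻¹) (q' * q⁻¹) s₂ = s₂ := by
  simp only [comm, mul_inv_rev, inv_inv, Equiv.Perm.mul_apply]
  have key : ∀ (p : Equiv.Perm (Fin 5)) t, p (p⁻¹ t) = t := fun p t => p.apply_symm_apply t
  rw [← h2, key, ← h1, key, ← h4, key, ← h3, key]

theorem Monodromy.IsBrady.comm_apply_ne (hM : M.IsBrady) (i : Fin 3) {a a' b b' : Fin 4}
    (ha : a ≠ a') (hb : b ≠ b') (t : Fin 5) :
    comm (M.α i a' * (M.α i a)⁻¹) (M.β i b' * (M.β i b)⁻¹) t ≠ t := by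
  have h1 := hM i a a' ha b b' hb
  have h2 := Equiv.Perm.sum_cycleType (comm (M.α i a' * (M.α i a)⁻¹) (M.β i b' * (M.β i b)⁻¹))
  rw [h1, Multiset.sum_singleton] at h2
  have h3 := Finset.eq_univ_of_card _ (h2.symm.trans (Fintype.card_fin 5).symm)
  exact Equiv.Perm.mem_support.1 (h3 ▸ Finset.mem_univ t)

/-- There are no `4`-cycles in the link of a component of the ramification locus. -/
theorem Monodromy.IsBrady.link_cycle (hM : M.IsBrady) {i k l : Fin 3} (hk : k ≠ i) (hl : l ≠ i)
    (hkl : k ≠ l) {x₀ x₁ y₀ y₁ : Flag} (hx₀ : Ram i x₀.v) (hx₁ : Ram i x₁.v) (hy₀ : Ram i y₀.v)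
    (hy₁ : Ram i y₁.v)
    (h1 : (Dart.mk M l x₀).linkVertex i = (Dart.mk M l x₁).linkVertex i)
    (h2 : (Dart.mk M k x₁).linkVertex i = (Dart.mk M k y₁).linkVertex i)
    (h3 : (Dart.mk M l y₁).linkVertex i = (Dart.mk M l y₀).linkVertex i)
    (h4 : (Dart.mk M k y₀).linkVertex i = (Dart.mk M k x₀).linkVertex i) :
    (Dart.mk M k x₀).linkVertex i = (Dart.mk M k x₁).linkVertex i ∨
      (Dart.mk M l x₁).linkVertex i = (Dart.mk M l y₁).linkVertex i := by
  -- Rotating the cycle by one edge exchanges the roles of `k` and `l`.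
  wlog h : k = i + 1 ∧ l = i + 2 generalizing k l x₀ x₁ y₀ y₁
  · have h' : l = i + 1 ∧ k = i + 2 := by
      clear h1 h2 h3 h4 hx₀ hx₁ hy₀ hy₁ this
      revert i k l
      decide
    rcases this hl hk hkl.symm hx₁ hy₁ hx₀ hy₀ h2 h3 h4 h1 h' with h5 | h5
    · exact .inr h5
    · exact .inl (h4.symm.trans (h5.symm.trans h2.symm))
  obtain ⟨rfl, rfl⟩ := h
  simp only [Dart.linkVertex_add_one, Dart.linkVertex_add_two, hx₀, hx₁, hy₀, hy₁, Prod.mk.injEq,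
    true_and] at h1 h2 h3 h4 ⊢
  obtain ⟨e1, h1⟩ := h1
  obtain ⟨e2, h2⟩ := h2
  obtain ⟨e3, h3⟩ := h3
  obtain ⟨e4, h4⟩ := h4
  rw [← e1] at h2 ⊢
  rw [← e2] at h3
  rw [← e3] at h4
  rw [e4] at h3
  rw [← e2]
  by_cases ha : x₀.e (i + 1) = x₁.e (i + 1)
  · rw [ha] at h1
    rw [(M.α i _)⁻¹.injective h1]
    exact .inl ⟨ha, rfl⟩
  by_cases hb : x₀.e (i + 2) = y₁.e (i + 2)
  · rw [hb] at h2
    rw [(M.β i _)⁻¹.injective h2]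
    exact .inr ⟨hb, rfl⟩
  refine absurd ?_ (hM.comm_apply_ne i ha hb (y₁.s i))
  exact comm_apply_eq h1 h2 h3 h4

end

/-! ### Ramified segments in isometric rectangles -/

section

variable {M : Monodromy} {x₀ : Vertex M}

/-- `f` is an isometric embedding of the `(C × D)`-rectangle. -/
def IsoGrid (C D : ℕ) (f : ℕ → ℕ → Cover x₀) : Prop :=
  ∀ x y x' y', x ≤ C → x' ≤ C → y ≤ D → y' ≤ D →
    (skeleton x₀).edist (f x y) (f x' y') = (Nat.dist x x' + Nat.dist y y' : ℕ)

theorem IsLift.adj {d : Dart M} {a b : Cover x₀} (h : IsLift d a b) : (skeleton x₀).Adj a b :=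
  edge_iff.2 ⟨d, trivial, h⟩

variable {C D : ℕ} {f : ℕ → ℕ → Cover x₀}

theorem IsoGrid.transpose (hf : IsoGrid C D f) : IsoGrid D C fun x y => f y x := by
  intro x y x' y' hx hx' hy hy'
  rw [hf _ _ _ _ hy hy' hx hx', add_comm]

theorem IsoGrid.ne (hf : IsoGrid C D f) {x y x' y' : ℕ} (hx : x ≤ C) (hx' : x' ≤ C) (hy : y ≤ D)
    (hy' : y' ≤ D) (h : x ≠ x' ∨ y ≠ y') : f x y ≠ f x' y' := by
  intro he
  have := hf _ _ _ _ hx hx' hy hy'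
  rw [he, SimpleGraph.edist_self] at this
  have h0 : Nat.dist x x' + Nat.dist y y' = 0 := by exact_mod_cast this.symm
  unfold Nat.dist at h0
  omega

theorem IsoGrid.exists_lift (hf : IsoGrid C D f) {x y x' y' : ℕ} (hx : x ≤ C) (hx' : x' ≤ C)
    (hy : y ≤ D) (hy' : y' ≤ D) (h : Nat.dist x x' + Nat.dist y y' = 1) :
    ∃ d, IsLift d (f x y) (f x' y') := by
  have := hf _ _ _ _ hx hx' hy hy'
  rw [h, Nat.cast_one, SimpleGraph.edist_eq_one_iff_adj] at this
  obtain ⟨d, -, hd⟩ := edge_iff.1 this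
  exact ⟨d, hd⟩

/-- A unit square of the grid is an embedded $4$-cycle, hence a $2$-cube. With `Nat.dist` one
statement serves all four squares at a vertex. -/
theorem IsoGrid.exists_flag (hf : IsoGrid C D f) {x y x' y' : ℕ} (hx : x ≤ C) (hx' : x' ≤ C)
    (hy : y ≤ D) (hy' : y' ≤ D) (hxx : Nat.dist x x' = 1) (hyy : Nat.dist y y' = 1)
    {d e : Dart M} (hd : IsLift d (f x y) (f x' y)) (he : IsLift e (f x y) (f x y')) :
    ∃ z k l, k ≠ l ∧ d = Dart.mk M k z ∧ e = Dart.mk M l z ∧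
      IsLift (Dart.mk M l (z.flip k)) (f x' y) (f x' y') := by
  obtain ⟨e', he'⟩ := hf.exists_lift hx' hx' hy hy' (by rw [Nat.dist_self, hyy])
  obtain ⟨d', hd'⟩ := hf.exists_lift hx hx' hy' hy' (by rw [Nat.dist_self, hxx])
  have hxn : x ≠ x' := by rintro rfl; simp at hxx
  obtain ⟨z, k, l, hkl, rfl, rfl, rfl, rfl⟩ := hd.sw he' he hd'
    (hf.ne hx hx' hy hy' (.inl hxn)) (hf.ne hx' hx hy hy' (.inl hxn.symm))
  exact ⟨z, k, l, hkl, rfl, rfl, he'⟩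

/-- A dart that leaves a segment over `L` sideways can be moved along this segment. -/
theorem IsLift.parallel {i : Fin 3} {p q p' : Cover x₀} {d h : Dart M} (hr : Ram i p.proj.corner)
    (hd : IsLift d p p') (hi : d.1 ≠ i) (hh : IsLift h p q) (hhi : h.1 = i) :
    ∃ d' q', IsLift d' q q' ∧ d'.linkVertex i = d.linkVertex i ∧ (skeleton x₀).Adj p' q' := by
  obtain ⟨l, x, rfl⟩ := d.exists_mk
  obtain ⟨k, z, rfl⟩ := h.exists_mk
  obtain rfl : k = i := hhi
  replace hi : l ≠ k := hi
  have hxz : Sim M ∅ x z := hd.src_eq.trans hh.src_eq.symm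
  rw [← hd.src_eq] at hr
  obtain ⟨w, w1, w2⟩ := Sim.exists_span (x := x) hr hxz hi
  rw [← Dart.mk_eq_mk.2 ⟨rfl, w1⟩] at hd ⊢
  rw [← Dart.mk_eq_mk.2 ⟨rfl, w2⟩] at hh
  obtain ⟨q', hq⟩ := IsLift.exists (a := q) (d := Dart.mk M l (w.flip k)) hh.tgt_eq
  refine ⟨_, q', hq, Dart.linkVertex_flip _ _ _, ?_⟩
  exact (IsLift.of_sw ⟨w, k, l, hi.symm, rfl, rfl, rfl, rfl⟩ hh hq hd).adj

theorem IsLift.corner_eq {d : Dart M} {a b : Cover x₀} (h : IsLift d a b) :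
    b.proj.corner = Function.update a.proj.corner d.1 (!a.proj.corner d.1) := by
  rw [← h.tgt_eq, ← h.src_eq, d.corner_tgt]

/-- A maximal horizontal segment of ramified edges which lies in the interior does not exist. -/
theorem IsoGrid.not_segment (hM : M.IsBrady) (hf : IsoGrid C D f) {a a' j : ℕ} {i : Fin 3}
    (ha : 1 ≤ a) (haa : a ≤ a') (ha' : a' + 1 ≤ C) (hj : 1 ≤ j) (hj' : j + 1 ≤ D)
    (hr : Ram i (f a j).proj.corner)
    (hseg : ∀ t, a ≤ t → t < a' → ∃ h, h.1 = i ∧ IsLift h (f t j) (f (t + 1) j))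
    (hup : ∀ d, IsLift d (f a j) (f a (j + 1)) → d.1 ≠ i)
    (hdown : ∀ d, IsLift d (f a j) (f a (j - 1)) → d.1 ≠ i)
    (hleft : ∀ d, IsLift d (f a j) (f (a - 1) j) → d.1 ≠ i)
    (hright : ∀ d, IsLift d (f a' j) (f (a' + 1) j) → d.1 ≠ i) : False := by
  obtain ⟨U, hU⟩ := hf.exists_lift (x := a) (y := j) (x' := a) (y' := j + 1) (by omega) (by omega)
    (by omega) hj' (by unfold Nat.dist; omega)
  obtain ⟨B, hB⟩ := hf.exists_lift (x := a) (y := j) (x' := a) (y' := j - 1) (by omega) (by omega)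
    (by omega) (by omega) (by unfold Nat.dist; omega)
  obtain ⟨E, hE⟩ := hf.exists_lift (x := a) (y := j) (x' := a - 1) (y' := j) (by omega) (by omega)
    (by omega) (by omega) (by unfold Nat.dist; omega)
  obtain ⟨R, hR⟩ := hf.exists_lift (x := a') (y := j) (x' := a' + 1) (y' := j) (by omega)
    (by omega) (by omega) (by omega) (by unfold Nat.dist; omega)
  have hUi := hup U hU
  have hBi := hdown B hB
  have hEi := hleft E hE
  have hRi := hright R hR
  -- Upward and downward darts remain edges of the rectangle, whereas `E` is pushed along the
  -- segment without control on where it goes; only the distance of its end point from the start is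
  -- recorded.
  have transport : ∀ t, a ≤ t → t ≤ a' → Ram i (f t j).proj.corner ∧
      (∃ U', IsLift U' (f t j) (f t (j + 1)) ∧ U'.linkVertex i = U.linkVertex i) ∧
      (∃ B', IsLift B' (f t j) (f t (j - 1)) ∧ B'.linkVertex i = B.linkVertex i) ∧
      ∃ E' q, IsLift E' (f t j) q ∧ E'.linkVertex i = E.linkVertex i ∧
        (skeleton x₀).edist (f (a - 1) j) q ≤ (t - a : ℕ) := by
    intro t hat
    induction t, hat using Nat.le_induction with
    | base =>
      exact fun _ => ⟨hr, ⟨U, hU, rfl⟩, ⟨B, hB, rfl⟩, E, _, hE, rfl, by simp⟩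
    | succ t hat ih =>
      intro hta
      obtain ⟨hr, ⟨U', hU', eU⟩, ⟨B', hB', eB⟩, E', q, hE', eE, hq⟩ := ih (by omega)
      obtain ⟨h, hhi, hh⟩ := hseg t hat (by omega)
      refine ⟨?_, ?_, ?_, ?_⟩
      · rw [hh.corner_eq, hhi]
        exact hr.update _
      · obtain ⟨z, k, l, -, rfl, rfl, h1⟩ := hf.exists_flag (by omega) (by omega) (by omega)
          (by omega) (by unfold Nat.dist; omega) (by unfold Nat.dist; omega) hh hU'
        obtain rfl : k = i := hhi
        exact ⟨_, h1, (Dart.linkVertex_flip _ _ _).trans eU⟩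
      · obtain ⟨z, k, l, -, rfl, rfl, h1⟩ := hf.exists_flag (by omega) (by omega) (by omega)
          (by omega) (by unfold Nat.dist; omega) (by unfold Nat.dist; omega) hh hB'
        obtain rfl : k = i := hhi
        exact ⟨_, h1, (Dart.linkVertex_flip _ _ _).trans eB⟩
      · have hi : E'.1 ≠ i := by
          rw [show E'.1 = E.1 from congrArg Prod.fst eE]
          exact hEi
        obtain ⟨E'', q', h1, h2, h3⟩ := hE'.parallel hr hi hh hhi
        refine ⟨E'', q', h1, h2.trans eE, ?_⟩
        calc _ ≤ (skeleton x₀).edist (f (a - 1) j) q + (skeleton x₀).edist q q' :=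
              SimpleGraph.edist_triangle
          _ ≤ (t - a : ℕ) + 1 := by
              rw [SimpleGraph.edist_eq_one_iff_adj.2 h3]
              gcongr
          _ = (t + 1 - a : ℕ) := by
              rw [show t + 1 - a = (t - a) + 1 by omega]
              push_cast
              rfl
  obtain ⟨hr', ⟨U', hU', eU⟩, ⟨B', hB', eB⟩, E', q, hE', eE, hq⟩ := transport a' haa le_rfl
  obtain ⟨z₀, l, k, hkl, rfl, rfl, -⟩ := hf.exists_flag (by omega) (by omega) (by omega)
    (by omega) (by unfold Nat.dist; omega) (by unfold Nat.dist; omega) hE hU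
  obtain ⟨z₁, l', k', hkl', h1, rfl, -⟩ := hf.exists_flag (by omega) (by omega) (by omega)
    (by omega) (by unfold Nat.dist; omega) (by unfold Nat.dist; omega) hE hB
  obtain ⟨y₀, m, n, hmn, rfl, rfl, -⟩ := hf.exists_flag (by omega) (by omega) (by omega)
    (by omega) (by unfold Nat.dist; omega) (by unfold Nat.dist; omega) hR hU'
  obtain ⟨y₁, m', n', -, h2, rfl, -⟩ := hf.exists_flag (by omega) (by omega) (by omega)
    (by omega) (by unfold Nat.dist; omega) (by unfold Nat.dist; omega) hR hB'
  obtain rfl : l = l' := congrArg Sigma.fst h1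
  obtain rfl : m = m' := congrArg Sigma.fst h2
  obtain rfl : n = k := congrArg Prod.fst eU
  obtain rfl : n' = k' := congrArg Prod.fst eB
  -- There is just one direction different from `i` and from that of `E`, so up and down are
  -- parallel, and so are left and right.
  have third : ∀ p q r s : Fin 3, p ≠ q → q ≠ s → p ≠ s → r ≠ q → r ≠ s → r = p := by
    intro p q r s
    omega
  obtain rfl : n' = n := third _ _ _ _ hUi hEi.symm hkl.symm hBi hkl'.symm
  obtain rfl : m = l := third _ _ _ _ hEi hUi.symm hkl hRi hmn
  have r₀ : Ram i z₀.v := by rw [← hU.src_eq] at hr; exact hr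
  have r₁ : Ram i z₁.v := by rw [← hB.src_eq] at hr; exact hr
  have r₂ : Ram i y₀.v := by rw [← hU'.src_eq] at hr'; exact hr'
  have r₃ : Ram i y₁.v := by rw [← hB'.src_eq] at hr'; exact hr'
  rcases hM.link_cycle (k := n') (l := m) hUi hEi hkl.symm r₀ r₁ r₂ r₃
    (congrArg (Dart.linkVertex i) h1) eB.symm (congrArg (Dart.linkVertex i) h2.symm) eU with h | h
  · have hUB := Dart.eq_of_linkVertex (by rw [hU.src_eq]; exact hr)
      (hU.src_eq.trans hB.src_eq.symm) hUi h
    rw [hUB] at hU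
    exact hf.ne (by omega) (by omega) hj' (by omega) (.inr (by omega)) (hU.tgt_unique hB)
  · have hi : E'.1 ≠ i := by
      rw [show E'.1 = _ from congrArg Prod.fst eE]
      exact hEi
    have hER := Dart.eq_of_linkVertex (by rw [hE'.src_eq]; exact hr')
      (hE'.src_eq.trans hR.src_eq.symm) hi (by rw [eE, h1, h, h2])
    rw [hER] at hE'
    -- The pushed left neighbour is the right neighbour: distance at most `a' - a` against `a' - a +
    -- 2` in the rectangle.
    rw [hE'.tgt_unique hR, hf _ _ _ _ (by omega) (by omega) (by omega) (by omega)] at hq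
    have hq : Nat.dist (a - 1) (a' + 1) + Nat.dist j j ≤ a' - a := by exact_mod_cast hq
    unfold Nat.dist at hq
    omega

end

/-! ### Ramified components in the interior -/

section

variable {M : Monodromy} {x₀ : Vertex M} {C D : ℕ} {f : ℕ → ℕ → Cover x₀}

/-- A set of vertices in the interior of a rectangle is not closed under adjacency by ramified
edges, if it contains a ramified vertex without vertical ramified edges. -/
theorem IsoGrid.not_interior_of_vertical (hM : M.IsBrady) (hf : IsoGrid C D f) {P : ℕ → ℕ → Prop}
    (hint : ∀ x y, P x y → 1 ≤ x ∧ x + 1 ≤ C ∧ 1 ≤ y ∧ y + 1 ≤ D)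
    (hadj : ∀ x y x' y', P x y → x' ≤ C → y' ≤ D → Nat.dist x x' + Nat.dist y y' = 1 →
      (∃ d : Dart M, d.IsRamified ∧ IsLift d (f x y) (f x' y')) → P x' y')
    {x y : ℕ} {i : Fin 3} (hP : P x y) (hr : Ram i (f x y).proj.corner)
    (hup : ∀ d, IsLift d (f x y) (f x (y + 1)) → d.1 ≠ i)
    (hdown : ∀ d, IsLift d (f x y) (f x (y - 1)) → d.1 ≠ i) : False := by
  have ram : ∀ {a b : Cover x₀} {d : Dart M}, Ram i a.proj.corner → IsLift d a b → d.1 = i →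
      d.IsRamified ∧ Ram i b.proj.corner := by
    rintro a b d hr hd rfl
    refine ⟨?_, ?_⟩
    · rw [← hd.src_eq] at hr
      exact hr
    · rw [hd.corner_eq]
      exact hr.update _
  -- Prolong along ramified edges as long as possible; `hadj` keeps the segment in `P`, so `hint`
  -- stops it before the boundary.
  have right : ∀ n t, C - t ≤ n → P t y → Ram i (f t y).proj.corner → ∃ a', t ≤ a' ∧ P a' y ∧
      (∀ s, t ≤ s → s < a' → ∃ h, h.1 = i ∧ IsLift h (f s y) (f (s + 1) y)) ∧
      ∀ d, IsLift d (f a' y) (f (a' + 1) y) → d.1 ≠ i := by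
    intro n
    induction n with
    | zero =>
      intro t ht hP
      have := hint _ _ hP
      omega
    | succ n ih =>
      intro t ht hP hr
      obtain ⟨h1, h2, h3, h4⟩ := hint _ _ hP
      by_cases h : ∃ d, IsLift d (f t y) (f (t + 1) y) ∧ d.1 = i
      · obtain ⟨d, hd, hdi⟩ := h
        obtain ⟨hdr, hr'⟩ := ram hr hd hdi
        obtain ⟨a', h5, h6, h7, h8⟩ := ih (t + 1) (by omega)
          (hadj _ _ _ _ hP h2 (by omega) (by unfold Nat.dist; omega) ⟨d, hdr, hd⟩) hr'
        refine ⟨a', by omega, h6, fun s hs hs' => ?_, h8⟩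
        rcases hs.eq_or_lt with rfl | hs
        · exact ⟨d, hdi, hd⟩
        · exact h7 s hs hs'
      · push Not at h
        exact ⟨t, le_rfl, hP, fun s hs hs' => by omega, h⟩
  have left : ∀ t, P t y → Ram i (f t y).proj.corner → ∃ a, a ≤ t ∧ P a y ∧
      Ram i (f a y).proj.corner ∧
      (∀ s, a ≤ s → s < t → ∃ h, h.1 = i ∧ IsLift h (f s y) (f (s + 1) y)) ∧
      ∀ d, IsLift d (f a y) (f (a - 1) y) → d.1 ≠ i := by
    intro t
    induction t with
    | zero =>
      intro hP
      have := hint _ _ hP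
      omega
    | succ t ih =>
      intro hP hr
      obtain ⟨h1, h2, h3, h4⟩ := hint _ _ hP
      by_cases h : ∃ d, IsLift d (f (t + 1) y) (f t y) ∧ d.1 = i
      · obtain ⟨d, hd, hdi⟩ := h
        obtain ⟨hdr, hr'⟩ := ram hr hd hdi
        obtain ⟨a, h5, h6, h7, h8, h9⟩ := ih
          (hadj _ _ _ _ hP (by omega) (by omega) (by unfold Nat.dist; omega) ⟨d, hdr, hd⟩) hr'
        refine ⟨a, by omega, h6, h7, fun s hs hs' => ?_, h9⟩
        rcases (Nat.lt_succ_iff.1 hs').eq_or_lt with rfl | hs''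
        · exact ⟨d.rev, hdi, hd.rev⟩
        · exact h8 s hs hs''
      · push Not at h
        exact ⟨t + 1, le_rfl, hP, hr, fun s hs hs' => by omega, h⟩
  obtain ⟨a', h1, h2, h3, h4⟩ := right _ x le_rfl hP hr
  obtain ⟨a, g1, g2, g3, g4, g5⟩ := left x hP hr
  have ha := hint _ _ g2
  have ha' := hint _ _ h2
  -- At the left end the hypothesis on `x` is replaced by the square on the first edge of the
  -- segment: that edge has direction `i`, so the vertical side does not.
  have vertical : ∀ y', Nat.dist y y' = 1 → y' ≤ D →
      (∀ d, IsLift d (f x y) (f x y') → d.1 ≠ i) → ∀ d, IsLift d (f a y) (f a y') → d.1 ≠ i := by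
    intro y' hy hy' hd d hda
    rcases g1.eq_or_lt with rfl | hlt
    · exact hd d hda
    · obtain ⟨h, rfl, hh⟩ := g4 a le_rfl hlt
      obtain ⟨z, k, l, hkl, rfl, rfl, -⟩ := hf.exists_flag (by omega) (by omega) (by omega) hy'
        (by unfold Nat.dist; omega) hy hh hda
      exact hkl.symm
  refine hf.not_segment hM ha.1 (g1.trans h1) ha'.2.1 ha.2.2.1 ha.2.2.2 g3 (fun t ht ht' => ?_)
    (vertical (y + 1) (by unfold Nat.dist; omega) (by omega) hup)
    (vertical (y - 1) (by unfold Nat.dist; omega) (by omega) hdown) g5 h4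
  rcases lt_or_ge t x with h | h
  · exact g4 t ht h
  · exact h3 t h ht'

/-- A nonempty set of ramified vertices in the interior of a rectangle is not closed under adjacency
by ramified edges. -/
theorem IsoGrid.not_interior (hM : M.IsBrady) (hf : IsoGrid C D f) {P : ℕ → ℕ → Prop}
    (hint : ∀ x y, P x y → 1 ≤ x ∧ x + 1 ≤ C ∧ 1 ≤ y ∧ y + 1 ≤ D)
    (hadj : ∀ x y x' y', P x y → x' ≤ C → y' ≤ D → Nat.dist x x' + Nat.dist y y' = 1 →
      (∃ d : Dart M, d.IsRamified ∧ IsLift d (f x y) (f x' y')) → P x' y')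
    {x y : ℕ} (hP : P x y) (hr : (f x y).IsRamified) : False := by
  obtain ⟨i, hr⟩ := hr
  obtain ⟨h1, h2, h3, h4⟩ := hint _ _ hP
  by_cases h : (∀ d, IsLift d (f x y) (f x (y + 1)) → d.1 ≠ i) ∧
      ∀ d, IsLift d (f x y) (f x (y - 1)) → d.1 ≠ i
  · exact hf.not_interior_of_vertical hM hint hadj hP hr h.1 h.2
  -- A vertical side in direction `i` excludes horizontal ones, since they span a square; the
  -- transposed rectangle then applies.
  have hor : ∀ y', Nat.dist y y' = 1 → y' ≤ D → (∃ d, IsLift d (f x y) (f x y') ∧ d.1 = i) →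
      ∀ x', Nat.dist x x' = 1 → x' ≤ C → ∀ d, IsLift d (f x y) (f x' y) → d.1 ≠ i := by
    rintro y' hy hy' ⟨e, he, rfl⟩ x' hx hx' d hd
    obtain ⟨z, k, l, hkl, rfl, rfl, -⟩ := hf.exists_flag (by omega) hx' (by omega) hy' hx hy hd he
    exact hkl
  have hex : ∃ y', Nat.dist y y' = 1 ∧ y' ≤ D ∧ ∃ d, IsLift d (f x y) (f x y') ∧ d.1 = i := by
    rw [not_and_or] at h
    push Not at h
    rcases h with h | h
    · exact ⟨y + 1, by unfold Nat.dist; omega, by omega, h⟩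
    · exact ⟨y - 1, by unfold Nat.dist; omega, by omega, h⟩
  obtain ⟨y', hy, hy', he⟩ := hex
  refine hf.transpose.not_interior_of_vertical hM (P := fun x y => P y x) (x := y) (y := x) (i := i)
    (fun a b hab => ?_) (fun a b a' b' hab ha' hb' hd he => ?_) hP hr ?_ ?_
  · have := hint _ _ hab
    omega
  · exact hadj _ _ _ _ hab hb' ha' (by omega) he
  · exact hor y' hy hy' he (x + 1) (by unfold Nat.dist; omega) (by omega)
  · exact hor y' hy hy' he (x - 1) (by unfold Nat.dist; omega) (by omega)

end

/-! ### The metric of the rectangle and the conclusion -/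

theorem edist_pathGraph {n : ℕ} (u v : Fin n) :
    (SimpleGraph.pathGraph n).edist u v = (Nat.dist u v : ℕ) := by
  have key : ∀ k : ℕ, ∀ u v : Fin n, (u : ℕ) + k = v →
      (SimpleGraph.pathGraph n).edist u v ≤ (k : ℕ) := by
    intro k
    induction k with
    | zero =>
      intro u v h
      obtain rfl : u = v := Fin.ext h
      simp
    | succ k ih =>
      intro u v h
      have h1 := ih u ⟨u + k, by omega⟩ rfl
      have h2 : (SimpleGraph.pathGraph n).Adj ⟨u + k, by omega⟩ v :=
        SimpleGraph.pathGraph_adj.2 (.inl (by simpa [add_assoc] using h))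
      refine ((SimpleGraph.pathGraph n).edist_triangle (v := ⟨u + k, by omega⟩)).trans ?_
      rw [SimpleGraph.edist_eq_one_iff_adj.2 h2]
      push_cast
      gcongr
  refine le_antisymm ?_ ?_
  · rcases le_total (u : ℕ) v with h | h
    · rw [Nat.dist_eq_sub_of_le h]
      exact key _ _ _ (by omega)
    · rw [Nat.dist_comm, Nat.dist_eq_sub_of_le h, SimpleGraph.edist_comm]
      exact key _ _ _ (by omega)
  · have walk : ∀ {u v : Fin n} (p : (SimpleGraph.pathGraph n).Walk u v),
        Nat.dist u v ≤ p.length := by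
      intro u v p
      induction p with
      | nil => simp
      | cons h p ih =>
        rw [SimpleGraph.Walk.length_cons]
        have := SimpleGraph.pathGraph_adj.1 h
        unfold Nat.dist at ih ⊢
        omega
    refine le_iInf fun p => ?_
    exact_mod_cast walk p

theorem edist_rectangle {C D : ℕ} (p q : Fin (C + 1) × Fin (D + 1)) :
    (rectangle C D).edist p q = (Nat.dist p.1 q.1 + Nat.dist p.2 q.2 : ℕ) := by
  rw [rectangle, SimpleGraph.edist_boxProd, edist_pathGraph, edist_pathGraph, Nat.cast_add]

end Brady

open Brady in
theorem not_component_disjoint_boundary {M : Monodromy} (hM : M.IsBrady) {x₀ : Vertex M} {C D : ℕ}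
    {φ : Fin (C + 1) × Fin (D + 1) → Cover x₀}
    (hφ : IsIsometricEmbedding (rectangle C D) (skeleton x₀) φ)
    (K : (ramifiedPart φ).coe.ConnectedComponent)
    (hK : ∀ p ∈ K.supp, (p : Fin (C + 1) × Fin (D + 1)) ∉ rectangleBoundary C D) : False := by
  obtain ⟨p, hp⟩ := K.nonempty_supp
  -- Natural number coordinates allow shifts and transposition. Outside the rectangle `Fin.ofNat`
  -- wraps around, but `IsoGrid` does not look there.
  let f : ℕ → ℕ → Cover x₀ := fun x y => φ (Fin.ofNat (C + 1) x, Fin.ofNat (D + 1) y)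
  have ofNat_val : ∀ {n x : ℕ}, x ≤ n → (Fin.ofNat (n + 1) x : ℕ) = x := fun h =>
    Nat.mod_eq_of_lt (Nat.lt_succ_of_le h)
  have hfv : ∀ q : Fin (C + 1) × Fin (D + 1), f q.1 q.2 = φ q := fun q => by
    change φ (_, _) = _
    congr 1
    exact Prod.ext (Fin.ext (ofNat_val (by omega))) (Fin.ext (ofNat_val (by omega)))
  have hf : IsoGrid C D f := by
    intro x y x' y' hx hx' hy hy'
    refine (hφ _ _).trans ?_
    rw [edist_rectangle, ofNat_val hx, ofNat_val hx', ofNat_val hy, ofNat_val hy']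
  refine hf.not_interior hM
    (P := fun x y => ∃ q ∈ K.supp, (q.1.1 : ℕ) = x ∧ (q.1.2 : ℕ) = y)
    ?_ ?_ ⟨p, hp, rfl, rfl⟩ (by rw [hfv]; exact p.2)
  · rintro _ _ ⟨q, hq, rfl, rfl⟩
    have := hK q hq
    simp only [rectangleBoundary, Set.mem_ofPred_eq, not_or, Fin.ext_iff, Fin.val_zero,
      Fin.val_last] at this
    omega
  · rintro _ _ x' y' ⟨q, hq, rfl, rfl⟩ hx' hy' hd he
    rw [hfv] at he
    have hadj : (ramifiedPart φ).Adj q.1 (Fin.ofNat (C + 1) x', Fin.ofNat (D + 1) y') := by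
      refine ⟨SimpleGraph.edist_eq_one_iff_adj.1 ?_, edge_iff.2 he⟩
      rw [edist_rectangle, ofNat_val hx', ofNat_val hy', hd, Nat.cast_one]
    refine ⟨⟨_, hadj.snd_mem⟩, ?_, ofNat_val hx', ofNat_val hy'⟩
    exact (SimpleGraph.ConnectedComponent.mem_supp_congr_adj K
      (show (ramifiedPart φ).coe.Adj q ⟨_, hadj.snd_mem⟩ from hadj)).1 hq

theorem proposition4 (M : Brady.Monodromy) (hM : M.IsBrady) (x₀ : Brady.Vertex M) (C D : ℕ)
    (φ : Fin (C + 1) × Fin (D + 1) → Brady.Cover x₀)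
    (hφ : Brady.IsIsometricEmbedding (Brady.rectangle C D) (Brady.skeleton x₀) φ) :
    (¬ ∃ K : (Brady.ramifiedPart φ).coe.ConnectedComponent,
      ∀ p ∈ K.supp, (p : Fin (C + 1) × Fin (D + 1)) ∉ Brady.rectangleBoundary C D) ∧
    (¬ ∃ p : Fin (C + 1) × Fin (D + 1), p ∉ Brady.rectangleBoundary C D ∧
      p ∈ (Brady.ramifiedPart φ).verts ∧ ∀ q, ¬ (Brady.ramifiedPart φ).Adj p q) := by
  refine ⟨fun ⟨K, hK⟩ => not_component_disjoint_boundary hM hφ K hK, ?_⟩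
  rintro ⟨p, hp, hpr, hiso⟩
  -- The component of an isolated vertex consists of this vertex alone, so it would avoid the
  -- boundary.
  refine not_component_disjoint_boundary hM hφ
    ((Brady.ramifiedPart φ).coe.connectedComponentMk ⟨p, hpr⟩) fun q hq => ?_
  have hpq : (Brady.ramifiedPart φ).coe.Reachable ⟨p, hpr⟩ q :=
    (SimpleGraph.ConnectedComponent.exact hq).symm
  obtain ⟨w⟩ := hpq
  cases w with
  | nil => exact hp
  | cons h _ => exact absurd h (hiso _)
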